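/- Let $D\ge 2$ be an integer and $\kappa>0$. For $x\in[-1,1]$ put $$U(x)=I_{\frac{x+1}{2}}\!\left(\tfrac{D-1}{2},\tfrac{D-1}{2}\right),\qquad F_\kappa(x)=\frac{\int_{-1}^{x}e^{\kappa t}(1-t^2)^{(D-3)/2}\,dt}{I_{D/2-1}(\kappa)\,\sqrt{\pi}\;\Gamma\!\left(\frac{D-1}{2}\right)(2/\kappa)^{D/2-1}},$$ where $I_y(a,b)=\frac{\Gamma(a+b)}{\Gamma(a)\Gamma(b)}\int_0^y t^{a-1}(1-t)^{b-1}\,dt$ is the regularized incomplete Beta function, $I_\nu(\kappa)=\sum_{m\ge0}\frac{(\kappa/2)^{2m+\nu}}{m!\,\Gamma(m+\nu+1)}$ is the modified Bessel function of the first kind, and $\Gamma$ is the Gamma function. Then: 1. $U$ and $F_\kappa$ are bijections from $[-1,1]$ onto $[0,1]$, and $h=F_\kappa^{-1}\circ U$ is a $C^\infty$ diffeomorphism of $[-1,1]$ onto itself. 2. The map $$\Phi_Z(x)=\left(x_1\sqrt{\tfrac{1-h(x_D)^2}{1-x_D^2}},\;\dots,\;x_{D-1}\sqrt{\tfrac{1-h(x_D)^2}{1-x_D^2}},\;h(x_D)\right)$$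 (where the first $D-1$ coordinates of the image are read as $0$ at the two poles $x_D=\pm1$) is a global $C^\infty$ diffeomorphism of the sphere $S^{D-1}\subset\mathbb{R}^D$ onto itself. 3. Let $\mu=(0,\dots,0,1)$ and let $$p_{\mathrm{vMF}}(z)=\frac{\kappa^{D/2-1}}{(2\pi)^{D/2}I_{D/2-1}(\kappa)}\,e^{\kappa\langle\mu,z\rangle}$$ be the von Mises–Fisher density on $S^{D-1}$ with mean direction $\mu$ and concentration $\kappa$, with respect to the surface measure. The image under $\Phi_Z$ of the uniform probability measure on $S^{D-1}$ is the probability measure with density $p_{\mathrm{vMF}}$. Moreover, the change-of-variables formula holds at every point $z\in S^{D-1}$: $$p_{\mathrm{vMF}}(z)=\frac{1}{|S^{D-1}|}\sqrt{\det\!\left(E^{T}J^{T}J\,E\right)},$$ where $|S^{D-1}|$ is the surface area, $J$ is the Jacobian at $z$, in the embedding coordinates, of $\Phi_Z^{-1}$ (extended differentiably to a neighbourhood of $z$), and $E$ is a $D\times(D-1)$ matrix whose columns are an orthonormal basis of the tangent space $z^\perp$. The right-hand side does not depend on the extension or on the basis. -/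

import Mathlib

open MeasureTheory Set Metric
open scoped Manifold ContDiff RealInnerProductSpace ENNReal

namespace VMF

noncomputable section

/-- The regularized incomplete Beta function
`I_y(a, b) = B(a, b)⁻¹ ∫₀^y t^(a-1) (1-t)^(b-1) dt`, where `B` is the Beta function. -/
def regIncBeta (y a b : ℝ) : ℝ :=
  (∫ t in (0 : ℝ)..y, t ^ (a - 1) * (1 - t) ^ (b - 1)) / ProbabilityTheory.beta a b

/-- The modified Bessel function of the first kind of order `ν` at `z > 0`:
`I_ν(z) = ∑ₘ (z/2)^(2m+ν) / (m! Γ(m+ν+1))`. -/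
def besselI (ν z : ℝ) : ℝ :=
  ∑' m : ℕ, (z / 2) ^ (2 * (m : ℝ) + ν) / ((m.factorial : ℝ) * Real.Gamma ((m : ℝ) + ν + 1))

/-- `U(x) = I_{(x+1)/2}((D-1)/2, (D-1)/2)`. -/
def U (D : ℕ) (x : ℝ) : ℝ :=
  regIncBeta ((x + 1) / 2) (((D : ℝ) - 1) / 2) (((D : ℝ) - 1) / 2)

/-- `F_κ(x)`, the integral of `e^{κt} (1-t²)^((D-3)/2)` over `[-1, x]`, divided by
`I_{D/2-1}(κ) √π Γ((D-1)/2) (2/κ)^(D/2-1)`. -/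
def F (D : ℕ) (κ x : ℝ) : ℝ :=
  (∫ t in (-1 : ℝ)..x, Real.exp (κ * t) * (1 - t ^ 2) ^ (((D : ℝ) - 3) / 2)) /
    (besselI ((D : ℝ) / 2 - 1) κ * √Real.pi * Real.Gamma (((D : ℝ) - 1) / 2) *
      (2 / κ) ^ ((D : ℝ) / 2 - 1))

/-- `h = F_κ⁻¹ ∘ U`, where `F_κ⁻¹` is the inverse of `F_κ` on `[-1, 1]`. -/
def h (D : ℕ) (κ x : ℝ) : ℝ :=
  Function.invFunOn (F D κ) (Icc (-1) 1) (U D x)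

/-- `g` restricts to a smooth diffeomorphism of the set `s ⊆ ℝ` onto itself. -/
def IsDiffeoOn (g : ℝ → ℝ) (s : Set ℝ) : Prop :=
  BijOn g s s ∧ ContDiffOn ℝ ∞ g s ∧ ContDiffOn ℝ ∞ (Function.invFunOn g s) s

/-- Euclidean space `ℝ^(n+1)`; its unit sphere has dimension `n`, so `D = n + 1`. -/
abbrev Amb (n : ℕ) : Type := EuclideanSpace ℝ (Fin (n + 1))

/-- The unit sphere `S^n = S^(D-1)` in `ℝ^(n+1) = ℝ^D`. -/
abbrev Sph (n : ℕ) : Type := sphere (0 : Amb n) 1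

/-- The map which sends the last coordinate `x_D` to `g(x_D)` and multiplies every other coordinate
by `√((1 - g(x_D)²) / (1 - x_D²))`. At the two poles the other coordinates of `x` vanish, and so do
those of the image, whatever value is given to the factor. -/
def axialMap (n : ℕ) (g : ℝ → ℝ) (x : Amb n) : Amb n :=
  WithLp.toLp 2 fun i =>
    if i = Fin.last n then g (x (Fin.last n))
    else x i * √((1 - g (x (Fin.last n)) ^ 2) / (1 - x (Fin.last n) ^ 2))

/-- The surface measure of the unit sphere. -/
def surfaceMeasure (n : ℕ) : Measure (Sph n) := (volume : Measure (Amb n)).toSphere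

/-- The uniform probability measure on the unit sphere. -/
def uniformMeasure (n : ℕ) : Measure (Sph n) :=
  (surfaceMeasure n univ)⁻¹ • surfaceMeasure n

/-- The density of the uniform distribution with respect to the surface measure. -/
def uniformDensity (n : ℕ) (_ : Sph n) : ℝ := ((surfaceMeasure n).real univ)⁻¹

/-- The von Mises-Fisher density with mean direction `μ` and concentration `κ`, with respect to the
surface measure: `κ^(D/2-1) / ((2π)^(D/2) I_{D/2-1}(κ)) * exp(κ ⟪μ, x⟫)`, where `D = n + 1`. -/
def vmfDensity (n : ℕ) (μ : Sph n) (κ : ℝ) (x : Sph n) : ℝ :=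
  κ ^ (((n + 1 : ℕ) : ℝ) / 2 - 1) /
      ((2 * Real.pi) ^ (((n + 1 : ℕ) : ℝ) / 2) * besselI (((n + 1 : ℕ) : ℝ) / 2 - 1) κ) *
    Real.exp (κ * ⟪(μ : Amb n), (x : Amb n)⟫)

/-- The von Mises-Fisher distribution. -/
def vmfMeasure (n : ℕ) (μ : Sph n) (κ : ℝ) : Measure (Sph n) :=
  (surfaceMeasure n).withDensity fun x => ENNReal.ofReal (vmfDensity n μ κ x)

/-- The point `(0, …, 0, 1)`. -/
def northPole (n : ℕ) : Sph n :=
  ⟨EuclideanSpace.single (Fin.last n) 1, by simp⟩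

/-- The extension of a self-map of the sphere to the ambient space, constant along rays. -/
def radialExt (n : ℕ) (f : Sph n → Sph n) (y : Amb n) : Amb n :=
  if hy : y = 0 then 0
  else f ⟨‖y‖⁻¹ • y, by simp [norm_smul, hy]⟩

/-- The density update `√det(Eᵀ Jᵀ J E)` of a self-map `f` of the sphere at `x`. Here `J` is the
Jacobian at `x` in the embedding coordinates and `E` is the isometric inclusion of the tangent space
`x^⊥` in the ambient space. The product `J E` is the same for all extensions of `f` to the ambient
space that are differentiable at `x`; the radial one is used. -/
def densityUpdate (n : ℕ) (f : Sph n → Sph n) (x : Sph n) : ℝ :=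
  let J : Amb n →L[ℝ] Amb n := fderiv ℝ (radialExt n f) (x : Amb n)
  let E : (ℝ ∙ (x : Amb n))ᗮ →L[ℝ] Amb n := (ℝ ∙ (x : Amb n))ᗮ.subtypeL
  let JE : (ℝ ∙ (x : Amb n))ᗮ →L[ℝ] Amb n := J ∘L E
  √(LinearMap.det
    ((ContinuousLinearMap.adjoint JE ∘L JE : (ℝ ∙ (x : Amb n))ᗮ →L[ℝ] (ℝ ∙ (x : Amb n))ᗮ) :
      (ℝ ∙ (x : Amb n))ᗮ →ₗ[ℝ] (ℝ ∙ (x : Amb n))ᗮ))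

/-- The density obtained from a base density `p₀` by the change of variables through `g`, the
inverse of the flow map: `p(z) = p₀(g(z)) · D_upd(g)(z)`. -/
def flowDensity (n : ℕ) (p₀ : Sph n → ℝ) (g : Sph n → Sph n) (z : Sph n) : ℝ :=
  p₀ (g z) * densityUpdate n g z

end

end VMF

/-! Put `n = D - 1` and `a = n / 2`. Up to an affine substitution, `U` and `F` are the mass
functions of two weights `(1-t²)^(a-1) ρ(t)` on `[-1, 1]` with `ρ` smooth and positive: constant for
`U`, a multiple of `e^(κt)` for `F`. Both have mass 1, by the Beta integral and by Poisson's
integral for the Bessel function. So `h` and its inverse are monotone transports between weights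
with the same singular factor, and one theory serves both.

Inside the interval a transport `g` is smooth by the inverse function theorem. At the endpoint 1,
the mass of `[1-y, 1]` is `y^a G(y)` with `G` smooth and positive (`cumul_one_sub`). Taking `a`-th
roots of the equality of masses gives `(1-g) G₂(1-g)^(1/a) = (1-x) G₁(1-x)^(1/a)`, where the inverse
function theorem applies again. The same equation shows that `(1-g)/(1-x)` is smooth and positive.
Reflection treats -1, so `r = √((1-g²)/(1-x²))` is smooth and positive on `[-1, 1]`. With `e` the
axis and `t` the last coordinate, the sphere map is `r(t) x + (g(t) - t r(t)) e`, which is smooth;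
the inverse profile gives its inverse.

An axial map stretches the `n - 1` directions of the parallel by `r` and the meridian by `g'/r`, so
its Jacobian is `r^(n-2) g'`. The transport equation, divided by `(1-x²)^(a-1)`, says that this is
`ρ₁(x)/ρ₂(g(x))`, at the poles too by continuity. For the inverse profile it is a multiple of
`e^(κt)`, and Legendre's duplication formula identifies the constant. The statement on measures then
follows from change of variables on the sphere, obtained from the Euclidean one by extending a
self-map homogeneously of degree one. -/

namespace VMF

open Filter Topology

/-! ### Smooth dependence on a parameter, and an implicit equation -/

section RpowIntegral

variable {s : Set ℝ} {a : ℝ} {φ : ℝ → ℝ}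

theorem mul_mem_of_convex (hc : Convex ℝ s) (h0 : (0 : ℝ) ∈ s) {y v : ℝ} (hy : y ∈ s)
    (hv : v ∈ Icc (0 : ℝ) 1) : y * v ∈ s := by
  have := hc h0 hy (sub_nonneg.2 hv.2) hv.1 (by ring)
  simpa [mul_comm] using this

/-- Compactness of the set of products gives a bound uniform in `y` near `y₀`: the domination needed
for continuity and for differentiation under the integral sign. -/
theorem exists_bound_comp_mul (hs : IsOpen s) (hc : Convex ℝ s) (h0 : (0 : ℝ) ∈ s)
    (hφ : ContinuousOn φ s) {y₀ : ℝ} (hy₀ : y₀ ∈ s) :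
    ∃ ε > 0, closedBall y₀ ε ⊆ s ∧
      ∃ C, ∀ y ∈ closedBall y₀ ε, ∀ v ∈ Icc (0 : ℝ) 1, |φ (y * v)| ≤ C := by
  obtain ⟨ε, hε, hb⟩ := Metric.nhds_basis_closedBall.mem_iff.1 (hs.mem_nhds hy₀)
  refine ⟨ε, hε, hb, ?_⟩
  have hK : IsCompact ((fun p : ℝ × ℝ => p.1 * p.2) '' (closedBall y₀ ε ×ˢ Icc (0 : ℝ) 1)) :=
    ((isCompact_closedBall _ _).prod isCompact_Icc).image (by fun_prop)
  have hKs : ((fun p : ℝ × ℝ => p.1 * p.2) '' (closedBall y₀ ε ×ˢ Icc (0 : ℝ) 1)) ⊆ s := by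
    rintro _ ⟨⟨y, v⟩, ⟨hy, hv⟩, rfl⟩
    exact mul_mem_of_convex hc h0 (hb hy) hv
  obtain ⟨C, hC⟩ := hK.exists_bound_of_continuousOn (hφ.mono hKs)
  exact ⟨C, fun y hy v hv => hC _ ⟨(y, v), ⟨hy, hv⟩, rfl⟩⟩

theorem aestronglyMeasurable_rpow_mul_comp (hc : Convex ℝ s) (h0 : (0 : ℝ) ∈ s)
    (hφ : ContinuousOn φ s) {y : ℝ} (hy : y ∈ s) :
    AEStronglyMeasurable (fun v => v ^ (a - 1) * φ (y * v)) (volume.restrict (uIoc (0 : ℝ) 1)) := by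
  rw [uIoc_of_le zero_le_one]
  refine ContinuousOn.aestronglyMeasurable ?_ measurableSet_Ioc
  refine ContinuousOn.mul (fun v hv => ?_) ?_
  · exact (Real.continuousAt_rpow_const _ _ (Or.inl hv.1.ne')).continuousWithinAt
  · exact hφ.comp (by fun_prop) fun v hv => mul_mem_of_convex hc h0 hy ⟨hv.1.le, hv.2⟩

theorem intervalIntegrable_rpow_bound (ha : 0 < a) (C : ℝ) :
    IntervalIntegrable (fun v => v ^ (a - 1) * C) volume 0 1 :=
  (intervalIntegral.intervalIntegrable_rpow' (by linarith)).mul_const C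

theorem intervalIntegrable_rpow_mul_comp (hs : IsOpen s) (hc : Convex ℝ s) (h0 : (0 : ℝ) ∈ s)
    (ha : 0 < a) (hφ : ContinuousOn φ s) {y : ℝ} (hy : y ∈ s) :
    IntervalIntegrable (fun v => v ^ (a - 1) * φ (y * v)) volume 0 1 := by
  obtain ⟨ε, hε, hb, C, hC⟩ := exists_bound_comp_mul hs hc h0 hφ hy
  refine (intervalIntegrable_rpow_bound ha C).mono_fun'
    (aestronglyMeasurable_rpow_mul_comp hc h0 hφ hy) ?_
  filter_upwards [ae_restrict_mem measurableSet_uIoc] with v hv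
  rw [uIoc_of_le zero_le_one] at hv
  rw [Real.norm_eq_abs, abs_mul, abs_of_nonneg (Real.rpow_nonneg hv.1.le _)]
  exact mul_le_mul_of_nonneg_left (hC y (mem_closedBall_self hε.le) v ⟨hv.1.le, hv.2⟩)
    (Real.rpow_nonneg hv.1.le _)

theorem continuousOn_integral_rpow_mul (hs : IsOpen s) (hc : Convex ℝ s) (h0 : (0 : ℝ) ∈ s)
    (ha : 0 < a) (hφ : ContinuousOn φ s) :
    ContinuousOn (fun y => ∫ v in (0 : ℝ)..1, v ^ (a - 1) * φ (y * v)) s := by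
  intro y₀ hy₀
  obtain ⟨ε, hε, hb, C, hC⟩ := exists_bound_comp_mul hs hc h0 hφ hy₀
  have hnear : ∀ᶠ y in 𝓝 y₀, y ∈ closedBall y₀ ε := closedBall_mem_nhds _ hε
  refine (intervalIntegral.continuousAt_of_dominated_interval (bound := fun v => v ^ (a - 1) * C)
    ?_ ?_ (intervalIntegrable_rpow_bound ha C) ?_).continuousWithinAt
  · filter_upwards [hnear] with y hy
    exact aestronglyMeasurable_rpow_mul_comp hc h0 hφ (hb hy)
  · filter_upwards [hnear] with y hy
    refine ae_of_all _ fun v hv => ?_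
    rw [uIoc_of_le zero_le_one] at hv
    rw [Real.norm_eq_abs, abs_mul, abs_of_nonneg (Real.rpow_nonneg hv.1.le _)]
    exact mul_le_mul_of_nonneg_left (hC y hy v ⟨hv.1.le, hv.2⟩) (Real.rpow_nonneg hv.1.le _)
  · refine ae_of_all _ fun v hv => ?_
    rw [uIoc_of_le zero_le_one] at hv
    refine ContinuousAt.mul continuousAt_const ?_
    exact ContinuousAt.comp (f := fun x => x * v) (hφ.continuousAt
      (hs.mem_nhds (mul_mem_of_convex hc h0 hy₀ ⟨hv.1.le, hv.2⟩))) (by fun_prop)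

/-- Differentiating in `y` brings out a factor `v`. The exponent is written `a + 1 - 1` so that the
derivative belongs to the same family, with `(a + 1, φ')` in place of `(a, φ)`; smoothness then
follows by induction. -/
theorem hasDerivAt_integral_rpow_mul (hs : IsOpen s) (hc : Convex ℝ s) (h0 : (0 : ℝ) ∈ s)
    (ha : 0 < a) (hφ : ContDiffOn ℝ 1 φ s) {y₀ : ℝ} (hy₀ : y₀ ∈ s) :
    HasDerivAt (fun y => ∫ v in (0 : ℝ)..1, v ^ (a - 1) * φ (y * v))
      (∫ v in (0 : ℝ)..1, v ^ (a + 1 - 1) * deriv φ (y₀ * v)) y₀ := by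
  have hφ' : ContinuousOn (deriv φ) s := hφ.continuousOn_deriv_of_isOpen hs le_rfl
  obtain ⟨ε, hε, hb, C, hC⟩ := exists_bound_comp_mul hs hc h0 hφ' hy₀
  have hnear : ∀ᶠ y in 𝓝 y₀, y ∈ closedBall y₀ ε := closedBall_mem_nhds _ hε
  refine (intervalIntegral.hasDerivAt_integral_of_dominated_loc_of_deriv_le
    (bound := fun v => v ^ (a + 1 - 1) * C)
    (F' := fun y v => v ^ (a + 1 - 1) * deriv φ (y * v)) hnear ?_
    (intervalIntegrable_rpow_mul_comp hs hc h0 ha hφ.continuousOn hy₀)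
    (aestronglyMeasurable_rpow_mul_comp hc h0 hφ' hy₀) ?_
    (intervalIntegrable_rpow_bound (by linarith) C) ?_).2
  · filter_upwards [hnear] with y hy
    exact aestronglyMeasurable_rpow_mul_comp hc h0 hφ.continuousOn (hb hy)
  · refine ae_of_all _ fun v hv y hy => ?_
    rw [uIoc_of_le zero_le_one] at hv
    rw [Real.norm_eq_abs, abs_mul, abs_of_nonneg (Real.rpow_nonneg hv.1.le _)]
    exact mul_le_mul_of_nonneg_left (hC y hy v ⟨hv.1.le, hv.2⟩) (Real.rpow_nonneg hv.1.le _)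
  · refine ae_of_all _ fun v hv y hy => ?_
    rw [uIoc_of_le zero_le_one] at hv
    have hm : y * v ∈ s := mul_mem_of_convex hc h0 (hb hy) ⟨hv.1.le, hv.2⟩
    have h1 : HasDerivAt φ (deriv φ (y * v)) (y * v) :=
      ((hφ.differentiableOn one_ne_zero).differentiableAt (hs.mem_nhds hm)).hasDerivAt
    have h2 := (h1.comp y (hasDerivAt_mul_const v)).const_mul (v ^ (a - 1))
    refine h2.congr_deriv ?_
    rw [show a + 1 - 1 = (a - 1) + 1 by ring, Real.rpow_add_one hv.1.ne']
    ring

theorem contDiffOn_nat_integral_rpow_mul (hs : IsOpen s) (hc : Convex ℝ s) (h0 : (0 : ℝ) ∈ s)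
    (m : ℕ) : ∀ {a : ℝ} {φ : ℝ → ℝ}, 0 < a → ContDiffOn ℝ m φ s →
      ContDiffOn ℝ m (fun y => ∫ v in (0 : ℝ)..1, v ^ (a - 1) * φ (y * v)) s := by
  induction m with
  | zero =>
    intro a φ ha hφ
    exact contDiffOn_zero.2 (continuousOn_integral_rpow_mul hs hc h0 ha hφ.continuousOn)
  | succ m ih =>
    intro a φ ha hφ
    have h1 : ContDiffOn ℝ 1 φ s := hφ.of_le (by simp)
    push_cast at hφ ⊢
    rw [contDiffOn_succ_iff_deriv_of_isOpen hs] at hφ ⊢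
    refine ⟨fun y hy => (hasDerivAt_integral_rpow_mul hs hc h0 ha h1
      hy).differentiableAt.differentiableWithinAt, by simp, ?_⟩
    refine (ih (a := a + 1) (by linarith) hφ.2.2).congr fun y hy => ?_
    exact (hasDerivAt_integral_rpow_mul hs hc h0 ha h1 hy).deriv

/-- The integral `∫₀¹ v^(a-1) φ(yv) dv` depends smoothly on `y`. -/
theorem contDiffOn_integral_rpow_mul (hs : IsOpen s) (hc : Convex ℝ s) (h0 : (0 : ℝ) ∈ s)
    (ha : 0 < a) (hφ : ContDiffOn ℝ ∞ φ s) :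
    ContDiffOn ℝ ∞ (fun y => ∫ v in (0 : ℝ)..1, v ^ (a - 1) * φ (y * v)) s :=
  contDiffOn_infty.2 fun m => contDiffOn_nat_integral_rpow_mul hs hc h0 m ha
    (hφ.of_le (by exact_mod_cast le_top))

end RpowIntegral

/-- A smooth solution `k` of `B (k x) = A x` near a point where `B' ≠ 0`. -/
theorem exists_contDiffAt_comp_eq {A B : ℝ → ℝ} {x₀ k₀ : ℝ} (hA : ContDiffAt ℝ ∞ A x₀)
    (hB : ContDiffAt ℝ ∞ B k₀) (hB' : deriv B k₀ ≠ 0) (hAB : A x₀ = B k₀) :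
    ∃ k : ℝ → ℝ, ContDiffAt ℝ ∞ k x₀ ∧ k x₀ = k₀ ∧ ∀ᶠ x in 𝓝 x₀, B (k x) = A x := by
  have hd : HasDerivAt B (deriv B k₀) k₀ := (hB.differentiableAt (by simp)).hasDerivAt
  have hf := hd.hasFDerivAt_equiv hB'
  refine ⟨fun x => hB.localInverse hf (by simp) (A x), ?_, ?_, ?_⟩
  · exact ContDiffAt.comp x₀ (g := hB.localInverse hf (by simp))
      (by rw [hAB]; exact hB.to_localInverse hf (by simp)) hA
  · simp only [hAB]
    exact hB.localInverse_apply_image hf (by simp)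
  · have h1 := hA.continuousAt.tendsto
    rw [hAB] at h1
    exact h1.eventually
      ((hB.hasStrictFDerivAt' hf (by simp)).eventually_right_inverse)

end VMF

/-! ### Weights on the interval and their mass functions -/

namespace VMF

open Filter Topology

noncomputable section

/-- The weight `(1-t²)^(a-1) ρ(t)` on `[-1, 1]`. -/
def wt (a : ℝ) (ρ : ℝ → ℝ) (t : ℝ) : ℝ := (1 - t ^ 2) ^ (a - 1) * ρ t

/-- The mass that the weight `wt a ρ` gives to `[-1, x]`. -/
def cumul (a : ℝ) (ρ : ℝ → ℝ) (x : ℝ) : ℝ := ∫ t in (-1 : ℝ)..x, wt a ρ t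

/-- The mass of `[1-y, 1]` divided by `y^a`, as an integral that is smooth in `y < 2`. -/
def tailFactor (a : ℝ) (ρ : ℝ → ℝ) (y : ℝ) : ℝ :=
  ∫ v in (0 : ℝ)..1, v ^ (a - 1) * ((2 - y * v) ^ (a - 1) * ρ (1 - y * v))

variable {a : ℝ} {ρ : ℝ → ℝ}

theorem wt_neg (t : ℝ) : wt a ρ (-t) = wt a (fun t => ρ (-t)) t := by simp [wt]

theorem one_sub_sq_pos {t : ℝ} (ht : t ∈ Ioo (-1 : ℝ) 1) : 0 < 1 - t ^ 2 := by
  nlinarith [ht.1, ht.2]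

/-- On this half the only possible singularity is `(1-t)^(a-1)` at 1, integrable since `a - 1 > -1`;
the other factors are continuous there. The left half follows by reflection. -/
theorem intervalIntegrable_wt_right (ha : 0 < a) (hρ : Continuous ρ) :
    IntervalIntegrable (wt a ρ) volume 0 1 := by
  have h1 : IntervalIntegrable (fun t : ℝ => (1 - t) ^ (a - 1)) volume 0 1 := by
    have := (intervalIntegral.intervalIntegrable_rpow' (a := 1) (b := 0)
      (r := a - 1) (by linarith)).comp_sub_left 1
    simpa using this
  have h2 : ContinuousOn (fun t : ℝ => (1 + t) ^ (a - 1) * ρ t) (uIcc 0 1) := by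
    refine ContinuousOn.mul (ContinuousOn.rpow_const (by fun_prop) fun t ht => Or.inl ?_)
      hρ.continuousOn
    rw [uIcc_of_le zero_le_one] at ht
    linarith [ht.1]
  refine (h1.mul_continuousOn h2).congr fun t ht => ?_
  rw [uIoc_of_le zero_le_one] at ht
  simp only [wt]
  rw [show 1 - t ^ 2 = (1 - t) * (1 + t) by ring,
    Real.mul_rpow (by linarith [ht.2]) (by linarith [ht.1])]
  ring

theorem intervalIntegrable_wt (ha : 0 < a) (hρ : Continuous ρ) {x y : ℝ}
    (hx : x ∈ Icc (-1 : ℝ) 1) (hy : y ∈ Icc (-1 : ℝ) 1) :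
    IntervalIntegrable (wt a ρ) volume x y := by
  have h1 := intervalIntegrable_wt_right ha hρ
  have h2 := intervalIntegrable_wt_right ha (hρ.comp continuous_neg)
  have h3 : IntervalIntegrable (wt a ρ) volume (-1) 0 := by
    rw [IntervalIntegrable.iff_comp_neg]
    simp only [wt_neg, neg_neg, neg_zero]
    exact h2.symm
  refine (h3.trans h1).mono_set ?_
  rw [uIcc_of_le (by norm_num : (-1 : ℝ) ≤ 1)]
  exact uIcc_subset_Icc hx hy

theorem left_mem : (-1 : ℝ) ∈ Icc (-1 : ℝ) 1 := by norm_num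
theorem right_mem : (1 : ℝ) ∈ Icc (-1 : ℝ) 1 := by norm_num

theorem cumul_sub (ha : 0 < a) (hρ : Continuous ρ) {x y : ℝ}
    (hx : x ∈ Icc (-1 : ℝ) 1) (hy : y ∈ Icc (-1 : ℝ) 1) :
    cumul a ρ y - cumul a ρ x = ∫ t in x..y, wt a ρ t :=
  intervalIntegral.integral_interval_sub_left (intervalIntegrable_wt ha hρ left_mem hy)
    (intervalIntegrable_wt ha hρ left_mem hx)

theorem cumul_left : cumul a ρ (-1) = 0 := by simp [cumul]

theorem wt_pos (hpos : ∀ t, 0 < ρ t) {t : ℝ} (ht : t ∈ Ioo (-1 : ℝ) 1) : 0 < wt a ρ t :=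
  mul_pos (Real.rpow_pos_of_pos (one_sub_sq_pos ht) _) (hpos t)

theorem strictMonoOn_cumul (ha : 0 < a) (hρ : Continuous ρ) (hpos : ∀ t, 0 < ρ t) :
    StrictMonoOn (cumul a ρ) (Icc (-1) 1) := by
  intro x hx y hy hxy
  rw [← sub_pos, cumul_sub ha hρ hx hy]
  refine intervalIntegral.intervalIntegral_pos_of_pos_on (intervalIntegrable_wt ha hρ hx hy)
    (fun t ht => wt_pos hpos ⟨by linarith [hx.1, ht.1], by linarith [hy.2, ht.2]⟩) hxy

theorem continuousOn_cumul (ha : 0 < a) (hρ : Continuous ρ) :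
    ContinuousOn (cumul a ρ) (Icc (-1) 1) := by
  have h := intervalIntegral.continuousOn_primitive_interval (f := wt a ρ) (a := -1) (b := 1)
    (μ := volume) ?_
  · rwa [uIcc_of_le (by norm_num : (-1 : ℝ) ≤ 1)] at h
  · rw [uIcc_of_le (by norm_num : (-1 : ℝ) ≤ 1), integrableOn_Icc_iff_integrableOn_Ioc]
    exact (intervalIntegrable_iff_integrableOn_Ioc_of_le (by norm_num)).1
      (intervalIntegrable_wt ha hρ left_mem right_mem)

theorem bijOn_cumul (ha : 0 < a) (hρ : Continuous ρ) (hpos : ∀ t, 0 < ρ t) :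
    BijOn (cumul a ρ) (Icc (-1) 1) (Icc 0 (cumul a ρ 1)) := by
  have hm := strictMonoOn_cumul ha hρ hpos
  refine ⟨fun x hx => ⟨?_, hm.monotoneOn hx right_mem hx.2⟩, hm.injOn, ?_⟩
  · rw [← cumul_left (a := a) (ρ := ρ)]
    exact hm.monotoneOn left_mem hx hx.1
  · have := intermediate_value_Icc (by norm_num : (-1 : ℝ) ≤ 1) (continuousOn_cumul ha hρ)
    rwa [cumul_left] at this

theorem contDiffOn_wt (hρ : ContDiff ℝ ∞ ρ) : ContDiffOn ℝ ∞ (wt a ρ) (Ioo (-1) 1) := by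
  refine ContDiffOn.mul (fun t ht => ?_) hρ.contDiffOn
  exact (ContDiffAt.rpow_const_of_ne (f := fun t : ℝ => 1 - t ^ 2) (by fun_prop)
    (one_sub_sq_pos ht).ne').contDiffWithinAt

theorem hasDerivAt_cumul (ha : 0 < a) (hρ : ContDiff ℝ ∞ ρ) {x : ℝ} (hx : x ∈ Ioo (-1 : ℝ) 1) :
    HasDerivAt (cumul a ρ) (wt a ρ x) x := by
  have hc := (contDiffOn_wt (a := a) hρ).continuousOn
  exact intervalIntegral.integral_hasDerivAt_right
    (intervalIntegrable_wt ha hρ.continuous left_mem ⟨hx.1.le, hx.2.le⟩)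
    (hc.stronglyMeasurableAtFilter isOpen_Ioo x hx) (hc.continuousAt (isOpen_Ioo.mem_nhds hx))

theorem contDiffAt_cumul (ha : 0 < a) (hρ : ContDiff ℝ ∞ ρ) {x : ℝ} (hx : x ∈ Ioo (-1 : ℝ) 1) :
    ContDiffAt ℝ ∞ (cumul a ρ) x := by
  refine ContDiffOn.contDiffAt (s := Ioo (-1 : ℝ) 1) ?_ (isOpen_Ioo.mem_nhds hx)
  rw [contDiffOn_infty_iff_deriv_of_isOpen isOpen_Ioo]
  refine ⟨fun y hy => (hasDerivAt_cumul ha hρ hy).differentiableAt.differentiableWithinAt, ?_⟩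
  exact (contDiffOn_wt hρ).congr fun y hy => (hasDerivAt_cumul ha hρ hy).deriv

theorem cumul_neg (ha : 0 < a) (hρ : Continuous ρ) {x : ℝ} (hx : x ∈ Icc (-1 : ℝ) 1) :
    cumul a (fun t => ρ (-t)) x = cumul a ρ 1 - cumul a ρ (-x) := by
  rw [cumul_sub ha hρ ⟨by linarith [hx.2], by linarith [hx.1]⟩ right_mem, cumul]
  simp only [← wt_neg]
  rw [intervalIntegral.integral_comp_neg (fun t => wt a ρ t), neg_neg]

theorem contDiffOn_tailFactor (ha : 0 < a) (hρ : ContDiff ℝ ∞ ρ) :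
    ContDiffOn ℝ ∞ (tailFactor a ρ) (Iio 2) := by
  refine contDiffOn_integral_rpow_mul (φ := fun u => (2 - u) ^ (a - 1) * ρ (1 - u)) isOpen_Iio
    (convex_Iio 2) (by norm_num) ha ?_
  refine ContDiffOn.mul (fun t ht => ?_) (hρ.comp (by fun_prop)).contDiffOn
  exact (ContDiffAt.rpow_const_of_ne (by fun_prop) (sub_pos.2 ht).ne').contDiffWithinAt

theorem tailFactor_pos (ha : 0 < a) (hρ : Continuous ρ) (hpos : ∀ t, 0 < ρ t) {y : ℝ}
    (hy : y < 2) : 0 < tailFactor a ρ y := by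
  refine intervalIntegral.intervalIntegral_pos_of_pos_on ?_ (fun v hv => ?_) zero_lt_one
  · refine intervalIntegrable_rpow_mul_comp (φ := fun u => (2 - u) ^ (a - 1) * ρ (1 - u))
      (s := Iio 2) isOpen_Iio (convex_Iio 2) (by norm_num) ha ?_ hy
    refine ContinuousOn.mul (ContinuousOn.rpow_const (by fun_prop) fun t ht => Or.inl ?_)
      (hρ.comp (by fun_prop)).continuousOn
    exact (sub_pos.2 ht).ne'
  · have : 0 < 2 - y * v := by nlinarith [hv.1, hv.2]
    exact mul_pos (Real.rpow_pos_of_pos hv.1 _) (mul_pos (Real.rpow_pos_of_pos this _) (hpos _))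

/-- The substitution `t = 1 - yv` turns `1 - t²` into `y · v(2 - yv)`. All the non-smoothness at the
endpoint is thus collected in the power `y^a`. -/
theorem cumul_one_sub (ha : 0 < a) (hρ : Continuous ρ) {y : ℝ} (hy : y ∈ Ico (0 : ℝ) 2) :
    cumul a ρ 1 - cumul a ρ (1 - y) = y ^ a * tailFactor a ρ y := by
  rcases hy.1.eq_or_lt with rfl | hy0
  · simp [Real.zero_rpow ha.ne']
  rw [cumul_sub ha hρ ⟨by linarith [hy.2], by linarith⟩ right_mem]
  have h1 := intervalIntegral.integral_comp_sub_mul (a := 0) (b := 1) (fun t => wt a ρ t)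
    hy0.ne' 1
  rw [mul_one, mul_zero, sub_zero, smul_eq_mul] at h1
  have h2 : ∫ v in (0 : ℝ)..1, wt a ρ (1 - y * v) = y ^ (a - 1) * tailFactor a ρ y := by
    rw [tailFactor, ← intervalIntegral.integral_const_mul]
    refine intervalIntegral.integral_congr fun v hv => ?_
    rw [uIcc_of_le zero_le_one] at hv
    have h3 : 0 ≤ 2 - y * v := by nlinarith [hv.1, hv.2, hy.2]
    simp only [wt]
    rw [show 1 - (1 - y * v) ^ 2 = y * (v * (2 - y * v)) by ring,
      Real.mul_rpow hy0.le (mul_nonneg hv.1 h3), Real.mul_rpow hv.1 h3]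
    ring
  rw [h2] at h1
  have h4 : y ^ a = y * y ^ (a - 1) := by
    rw [mul_comm, ← Real.rpow_add_one hy0.ne', sub_add_cancel]
  rw [h4, mul_assoc, h1, mul_inv_cancel_left₀ hy0.ne']

end

end VMF

/-! ### Regularity of the monotone transport up to the endpoints -/

namespace VMF

open Filter Topology

/-- The self-map `g` of `[-1, 1]` is the monotone transport from `wt a ρ₁` to `wt a ρ₂`, two smooth
positive multiples of `(1-t²)^(a-1)` with the same mass. -/
structure IsTransport (a : ℝ) (ρ₁ ρ₂ g : ℝ → ℝ) : Prop where
  exponent_pos : 0 < a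
  smooth_left : ContDiff ℝ ∞ ρ₁
  pos_left : ∀ t, 0 < ρ₁ t
  smooth_right : ContDiff ℝ ∞ ρ₂
  pos_right : ∀ t, 0 < ρ₂ t
  mass_eq : cumul a ρ₁ 1 = cumul a ρ₂ 1
  mapsTo : MapsTo g (Icc (-1) 1) (Icc (-1) 1)
  cumul_eq : ∀ x ∈ Icc (-1 : ℝ) 1, cumul a ρ₂ (g x) = cumul a ρ₁ x

namespace IsTransport

variable {a : ℝ} {ρ₁ ρ₂ g : ℝ → ℝ}

/-- Conjugation by `t ↦ -t` carries each result at the endpoint 1 over to -1. -/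
theorem neg (T : IsTransport a ρ₁ ρ₂ g) :
    IsTransport a (fun t => ρ₁ (-t)) (fun t => ρ₂ (-t)) (fun x => -g (-x)) where
  exponent_pos := T.exponent_pos
  smooth_left := T.smooth_left.comp contDiff_neg
  pos_left t := T.pos_left _
  smooth_right := T.smooth_right.comp contDiff_neg
  pos_right t := T.pos_right _
  mass_eq := by
    rw [cumul_neg T.exponent_pos T.smooth_left.continuous right_mem,
      cumul_neg T.exponent_pos T.smooth_right.continuous right_mem, T.mass_eq, cumul_left,
      cumul_left]
  mapsTo x hx := by
    have := T.mapsTo (x := -x) ⟨by linarith [hx.2], by linarith [hx.1]⟩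
    exact ⟨by linarith [this.2], by linarith [this.1]⟩
  cumul_eq x hx := by
    have hx' : -x ∈ Icc (-1 : ℝ) 1 := ⟨by linarith [hx.2], by linarith [hx.1]⟩
    have := T.mapsTo hx'
    rw [cumul_neg T.exponent_pos T.smooth_left.continuous hx,
      cumul_neg T.exponent_pos T.smooth_right.continuous
        ⟨by linarith [this.2], by linarith [this.1]⟩, T.mass_eq, neg_neg, T.cumul_eq _ hx']

theorem eq_of_cumul_eq (T : IsTransport a ρ₁ ρ₂ g) {x y : ℝ} (hx : x ∈ Icc (-1 : ℝ) 1)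
    (hy : y ∈ Icc (-1 : ℝ) 1) (hxy : cumul a ρ₂ y = cumul a ρ₁ x) : g x = y :=
  (strictMonoOn_cumul T.exponent_pos T.smooth_right.continuous T.pos_right).injOn (T.mapsTo hx) hy
    ((T.cumul_eq x hx).trans hxy.symm)

theorem apply_one (T : IsTransport a ρ₁ ρ₂ g) : g 1 = 1 :=
  T.eq_of_cumul_eq right_mem right_mem T.mass_eq.symm

theorem apply_neg_one (T : IsTransport a ρ₁ ρ₂ g) : g (-1) = -1 :=
  T.eq_of_cumul_eq left_mem left_mem (by rw [cumul_left, cumul_left])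

theorem strictMonoOn (T : IsTransport a ρ₁ ρ₂ g) : StrictMonoOn g (Icc (-1) 1) := by
  intro x hx y hy hxy
  rw [← (strictMonoOn_cumul T.exponent_pos T.smooth_right.continuous T.pos_right).lt_iff_lt
    (T.mapsTo hx) (T.mapsTo hy), T.cumul_eq x hx, T.cumul_eq y hy]
  exact strictMonoOn_cumul T.exponent_pos T.smooth_left.continuous T.pos_left hx hy hxy

theorem mem_Ioo (T : IsTransport a ρ₁ ρ₂ g) {x : ℝ} (hx : x ∈ Ioo (-1 : ℝ) 1) :
    g x ∈ Ioo (-1 : ℝ) 1 := by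
  have h1 := T.strictMonoOn left_mem ⟨hx.1.le, hx.2.le⟩ hx.1
  have h2 := T.strictMonoOn ⟨hx.1.le, hx.2.le⟩ right_mem hx.2
  rw [T.apply_neg_one] at h1
  rw [T.apply_one] at h2
  exact ⟨h1, h2⟩

/-- The inverse function theorem yields a smooth local solution `k`, and strict monotonicity of the
mass function forces `g = k`. No prior continuity of `g` is needed. -/
theorem contDiffAt (T : IsTransport a ρ₁ ρ₂ g) {x : ℝ} (hx : x ∈ Ioo (-1 : ℝ) 1) :
    ContDiffAt ℝ ∞ g x := by
  have hgx := T.mem_Ioo hx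
  obtain ⟨k, hk, hk0, hke⟩ := exists_contDiffAt_comp_eq (A := cumul a ρ₁) (B := cumul a ρ₂)
    (contDiffAt_cumul T.exponent_pos T.smooth_left hx)
    (contDiffAt_cumul T.exponent_pos T.smooth_right hgx)
    (by rw [(hasDerivAt_cumul T.exponent_pos T.smooth_right hgx).deriv]
        exact (wt_pos T.pos_right hgx).ne')
    (T.cumul_eq x ⟨hx.1.le, hx.2.le⟩).symm
  refine hk.congr_of_eventuallyEq ?_
  have h1 : ∀ᶠ y in 𝓝 x, k y ∈ Ioo (-1 : ℝ) 1 :=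
    hk.continuousAt.eventually_mem (isOpen_Ioo.mem_nhds (by rwa [hk0]))
  filter_upwards [hke, h1, isOpen_Ioo.mem_nhds hx] with y hy hky hyI
  exact T.eq_of_cumul_eq ⟨hyI.1.le, hyI.2.le⟩ ⟨hky.1.le, hky.2.le⟩ hy

theorem contDiffAt_mul_tailFactor_rpow {ρ : ℝ → ℝ} (ha : 0 < a) (hρ : ContDiff ℝ ∞ ρ)
    (hpos : ∀ t, 0 < ρ t) : ContDiffAt ℝ ∞ (fun y => tailFactor a ρ y ^ (1 / a)) 0 :=
  ((contDiffOn_tailFactor ha hρ).contDiffAt (Iio_mem_nhds two_pos)).rpow_const_of_ne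
    (tailFactor_pos ha hρ.continuous hpos two_pos).ne'

theorem rpow_one_div_rpow (ha : 0 < a) {x : ℝ} (hx : 0 ≤ x) : (x ^ (1 / a)) ^ a = x := by
  rw [← Real.rpow_mul hx, one_div_mul_cancel ha.ne', Real.rpow_one]

/-- With `y = 1 - x`, equality of masses reads `k^a G₂(k) = y^a G₁(y)` for `k = 1 - g x`. Its `a`-th
root is an equation between functions smooth across 0, and the right factor `k G₂(k)^(1/a)` has
derivative `G₂(0)^(1/a) ≠ 0` there. -/
theorem contDiffWithinAt_one (T : IsTransport a ρ₁ ρ₂ g) :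
    ContDiffWithinAt ℝ ∞ g (Icc (-1) 1) 1 := by
  have ha := T.exponent_pos
  have hG₁ : ∀ y < 2, 0 < tailFactor a ρ₁ y :=
    fun y hy => tailFactor_pos ha T.smooth_left.continuous T.pos_left hy
  have hG₂ : ∀ y < 2, 0 < tailFactor a ρ₂ y :=
    fun y hy => tailFactor_pos ha T.smooth_right.continuous T.pos_right hy
  have hA := contDiffAt_mul_tailFactor_rpow ha T.smooth_left T.pos_left
  have hB := contDiffAt_mul_tailFactor_rpow ha T.smooth_right T.pos_right
  have hB' : deriv (fun y => y * tailFactor a ρ₂ y ^ (1 / a)) 0 ≠ 0 := by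
    have h := (hasDerivAt_id (0 : ℝ)).mul (hB.differentiableAt (by simp)).hasDerivAt
    have h' : HasDerivAt (fun y => y * tailFactor a ρ₂ y ^ (1 / a)) _ 0 := h
    rw [h'.deriv]
    simpa using (Real.rpow_pos_of_pos (hG₂ 0 two_pos) _).ne'
  obtain ⟨k, hk, hk0, hke⟩ := exists_contDiffAt_comp_eq
    (A := fun y => y * tailFactor a ρ₁ y ^ (1 / a)) (B := fun y => y * tailFactor a ρ₂ y ^ (1 / a))
    (contDiffAt_id.mul hA) (contDiffAt_id.mul hB) hB' (by simp)
  have hsub : ContDiffAt ℝ ∞ (fun x : ℝ => 1 - k (1 - x)) 1 := by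
    refine contDiffAt_const.sub (ContDiffAt.comp (1 : ℝ) (g := k) ?_ (by fun_prop))
    simpa using hk
  have ht : Tendsto (fun x : ℝ => 1 - x) (𝓝 1) (𝓝 0) := by
    have : ContinuousAt (fun x : ℝ => 1 - x) 1 := by fun_prop
    simpa [ContinuousAt] using this
  have hk1 : ∀ᶠ y in 𝓝 (0 : ℝ), k y < 2 :=
    hk.continuousAt.eventually_mem (Iio_mem_nhds (by rw [hk0]; exact two_pos))
  refine hsub.contDiffWithinAt.congr_of_eventuallyEq_of_mem ?_ right_mem
  filter_upwards [mem_nhdsWithin_of_mem_nhds (ht.eventually hke),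
    mem_nhdsWithin_of_mem_nhds (ht.eventually hk1),
    mem_nhdsWithin_of_mem_nhds (ht.eventually (Iio_mem_nhds (two_pos : (0 : ℝ) < 2))),
    self_mem_nhdsWithin] with x h1 h2 h3 hx
  replace h3 : 1 - x < 2 := h3
  have hx0 : 0 ≤ 1 - x := by linarith [hx.2]
  have hpA : 0 < tailFactor a ρ₁ (1 - x) ^ (1 / a) := Real.rpow_pos_of_pos (hG₁ _ h3) _
  have hpB : 0 < tailFactor a ρ₂ (k (1 - x)) ^ (1 / a) := Real.rpow_pos_of_pos (hG₂ _ h2) _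
  -- The solution `k` lives on both sides of 0; for `x ≤ 1` the rooted equation shows that it has
  -- the sign of `1 - x`, which permits returning to `a`-th powers.
  have hk_nonneg : 0 ≤ k (1 - x) := by
    by_contra! hneg
    have := mul_nonneg hx0 hpA.le
    rw [← h1] at this
    exact absurd this (not_le.2 (mul_neg_of_neg_of_pos hneg hpB))
  refine T.eq_of_cumul_eq hx ⟨by linarith, by linarith⟩ ?_
  have e := congrArg (· ^ a) h1
  rw [Real.mul_rpow hk_nonneg hpB.le, Real.mul_rpow hx0 hpA.le, rpow_one_div_rpow ha (hG₁ _ h3).le,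
    rpow_one_div_rpow ha (hG₂ _ h2).le, ← cumul_one_sub ha T.smooth_right.continuous
    ⟨hk_nonneg, h2⟩, ← cumul_one_sub ha T.smooth_left.continuous ⟨hx0, h3⟩, T.mass_eq,
    sub_sub_cancel 1 x] at e
  linarith

theorem contDiffOn (T : IsTransport a ρ₁ ρ₂ g) : ContDiffOn ℝ ∞ g (Icc (-1) 1) := by
  intro x hx
  rcases hx.1.eq_or_lt with rfl | hx1
  · have h := T.neg.contDiffWithinAt_one
    have h' : ContDiffWithinAt ℝ ∞ ((fun x => -g (-x)) ∘ Neg.neg) (Icc (-1 : ℝ) 1) (-1) := by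
      refine ContDiffWithinAt.comp (-1 : ℝ) (t := Icc (-1 : ℝ) 1) (by simpa using h)
        contDiff_neg.contDiffWithinAt fun x hx => ⟨by linarith [hx.2], by linarith [hx.1]⟩
    simpa [Function.comp_def] using h'.neg
  · rcases hx.2.eq_or_lt with rfl | hx2
    · exact T.contDiffWithinAt_one
    · exact (T.contDiffAt ⟨hx1, hx2⟩).contDiffWithinAt

/-- `(1 - g x) / (1 - x)` extends to a smooth positive function on `(-1, 1]`. -/
theorem exists_one_sub_eq (T : IsTransport a ρ₁ ρ₂ g) :
    ∃ m : ℝ → ℝ, ContDiffOn ℝ ∞ m (Ioc (-1) 1) ∧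
      ∀ x ∈ Ioc (-1 : ℝ) 1, 0 < m x ∧ 1 - g x = (1 - x) * m x := by
  have ha := T.exponent_pos
  have hsub : Ioc (-1 : ℝ) 1 ⊆ Icc (-1) 1 := Ioc_subset_Icc_self
  have hg2 : ∀ x ∈ Ioc (-1 : ℝ) 1, 1 - g x < 2 := fun x hx => by
    have := T.strictMonoOn left_mem (hsub hx) hx.1
    rw [T.apply_neg_one] at this
    linarith
  have hG₁ : ∀ x ∈ Ioc (-1 : ℝ) 1, 0 < tailFactor a ρ₁ (1 - x) :=
    fun x hx => tailFactor_pos ha T.smooth_left.continuous T.pos_left (by linarith [hx.1])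
  have hG₂ : ∀ x ∈ Ioc (-1 : ℝ) 1, 0 < tailFactor a ρ₂ (1 - g x) :=
    fun x hx => tailFactor_pos ha T.smooth_right.continuous T.pos_right (hg2 x hx)
  -- Solved from `(1-g)^a G₂(1-g) = (1-x)^a G₁(1-x)`.
  refine ⟨fun x => (tailFactor a ρ₁ (1 - x) / tailFactor a ρ₂ (1 - g x)) ^ (1 / a), ?_, ?_⟩
  · intro x hx
    refine ContDiffWithinAt.rpow_const_of_ne (ContDiffWithinAt.div ?_ ?_ (hG₂ x hx).ne')
      (div_pos (hG₁ x hx) (hG₂ x hx)).ne'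
    · exact ((contDiffOn_tailFactor ha T.smooth_left).comp (f := fun x => 1 - x)
        (s := Ioc (-1 : ℝ) 1) (by fun_prop) fun y hy => by
          simp only [mem_Iio]; linarith [hy.1]) x hx
    · exact ((contDiffOn_tailFactor ha T.smooth_right).comp (f := fun x => 1 - g x)
        (s := Ioc (-1 : ℝ) 1) (contDiffOn_const.sub (T.contDiffOn.mono hsub))
        fun y hy => hg2 y hy) x hx
  · intro x hx
    have h1 := div_pos (hG₁ x hx) (hG₂ x hx)
    have h2 := Real.rpow_pos_of_pos h1 (1 / a)
    refine ⟨h2, ?_⟩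
    have hx0 : 0 ≤ 1 - x := by linarith [hx.2]
    have hg0 : 0 ≤ 1 - g x := by linarith [(T.mapsTo (hsub hx)).2]
    have e1 := cumul_one_sub ha T.smooth_left.continuous (y := 1 - x) ⟨hx0, by linarith [hx.1]⟩
    have e2 := cumul_one_sub ha T.smooth_right.continuous (y := 1 - g x) ⟨hg0, hg2 x hx⟩
    rw [sub_sub_cancel] at e1 e2
    rw [T.cumul_eq x (hsub hx), ← T.mass_eq, e1] at e2
    rw [← Real.rpow_left_inj hg0 (mul_nonneg hx0 h2.le) ha.ne', Real.mul_rpow hx0 h2.le,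
      rpow_one_div_rpow ha h1.le, ← mul_div_assoc, e2, mul_div_cancel_right₀ _ (hG₂ x hx).ne']

/-- `√((1 - g²) / (1 - x²))` extends to a smooth positive function on `[-1, 1]`. -/
theorem exists_one_sub_sq_eq (T : IsTransport a ρ₁ ρ₂ g) :
    ∃ r : ℝ → ℝ, ContDiffOn ℝ ∞ r (Icc (-1) 1) ∧
      ∀ x ∈ Icc (-1 : ℝ) 1, 0 < r x ∧ 1 - g x ^ 2 = r x ^ 2 * (1 - x ^ 2) := by
  obtain ⟨m, hm, hm'⟩ := T.exists_one_sub_eq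
  obtain ⟨p, hp, hp'⟩ := T.neg.exists_one_sub_eq
  have hgx : ∀ x ∈ Icc (-1 : ℝ) 1, -1 < x → -1 < g x := fun x hx h => by
    have := T.strictMonoOn left_mem hx h
    rwa [T.apply_neg_one] at this
  have hgx' : ∀ x ∈ Icc (-1 : ℝ) 1, x < 1 → g x < 1 := fun x hx h => by
    have := T.strictMonoOn hx right_mem h
    rwa [T.apply_one] at this
  -- Both represent `(1-g²)/(1-x²)`: `q₁` is smooth away from -1 and `q₂` away from 1. They agree on
  -- the open interval, so they glue to `q`; the choice of 0 as the switching point is immaterial.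
  set q₁ : ℝ → ℝ := fun x => m x * ((1 + g x) / (1 + x)) with hq₁
  set q₂ : ℝ → ℝ := fun x => p (-x) * ((1 - g x) / (1 - x)) with hq₂
  have hgI := T.contDiffOn
  have c₁ : ContDiffOn ℝ ∞ q₁ (Ioc (-1) 1) := by
    have hg' := hgI.mono (Ioc_subset_Icc_self : Ioc (-1 : ℝ) 1 ⊆ _)
    refine hm.mul ((contDiffOn_const.add hg').div (by fun_prop) fun x hx => ?_)
    linarith [hx.1]
  have c₂ : ContDiffOn ℝ ∞ q₂ (Ico (-1) 1) := by
    have hg' := hgI.mono (Ico_subset_Icc_self : Ico (-1 : ℝ) 1 ⊆ _)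
    refine (hp.comp (f := fun x => -x) (by fun_prop) fun x hx => ⟨by linarith [hx.2],
      by linarith [hx.1]⟩).mul ((contDiffOn_const.sub hg').div (by fun_prop) fun x hx => ?_)
    linarith [hx.2]
  have e₁ : ∀ x ∈ Ioc (-1 : ℝ) 1, 0 < q₁ x ∧ 1 - g x ^ 2 = q₁ x * (1 - x ^ 2) := by
    intro x hx
    have h1 := hgx x (Ioc_subset_Icc_self hx) hx.1
    have h2 : 0 < 1 + x := by linarith [hx.1]
    refine ⟨mul_pos (hm' x hx).1 (div_pos (by linarith) h2), ?_⟩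
    rw [hq₁]
    field_simp
    linear_combination (1 + g x) * (1 + x) * (hm' x hx).2
  have e₂ : ∀ x ∈ Ico (-1 : ℝ) 1, 0 < q₂ x ∧ 1 - g x ^ 2 = q₂ x * (1 - x ^ 2) := by
    intro x hx
    have h1 := hgx' x (Ico_subset_Icc_self hx) hx.2
    have h2 : 0 < 1 - x := by linarith [hx.2]
    have h3 := hp' (-x) ⟨by linarith [hx.2], by linarith [hx.1]⟩
    rw [neg_neg] at h3
    refine ⟨mul_pos h3.1 (div_pos (by linarith) h2), ?_⟩
    rw [hq₂]
    field_simp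
    linear_combination (1 - g x) * (1 - x) * h3.2
  have e₁₂ : ∀ x ∈ Ioo (-1 : ℝ) 1, q₁ x = q₂ x := fun x hx =>
    mul_right_cancel₀ (one_sub_sq_pos hx).ne' ((e₁ x ⟨hx.1, hx.2.le⟩).2.symm.trans
      (e₂ x ⟨hx.1.le, hx.2⟩).2)
  set q : ℝ → ℝ := fun x => if x < 0 then q₂ x else q₁ x with hq
  have f₁ : EqOn q q₁ (Ioc (-1) 1) := fun x hx => by
    by_cases h : x < 0
    · rw [hq, e₁₂ x ⟨hx.1, by linarith⟩]; simp [h]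
    · simp [hq, h]
  have f₂ : EqOn q q₂ (Ico (-1) 1) := fun x hx => by
    by_cases h : x < 0
    · simp [hq, h]
    · rw [hq, ← e₁₂ x ⟨by linarith, hx.2⟩]; simp [h]
  have hqpos : ∀ x ∈ Icc (-1 : ℝ) 1, 0 < q x ∧ 1 - g x ^ 2 = q x * (1 - x ^ 2) := by
    intro x hx
    by_cases h : x < 0
    · have hx' : x ∈ Ico (-1 : ℝ) 1 := ⟨hx.1, by linarith⟩
      rw [f₂ hx']; exact e₂ x hx'
    · have hx' : x ∈ Ioc (-1 : ℝ) 1 := ⟨by linarith, hx.2⟩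
      rw [f₁ hx']; exact e₁ x hx'
  have hqs : ContDiffOn ℝ ∞ q (Icc (-1) 1) := by
    intro x hx
    by_cases h : x < 0
    · have hx' : x ∈ Ico (-1 : ℝ) 1 := ⟨hx.1, by linarith⟩
      refine ((c₂.congr f₂) x hx').mono_of_mem_nhdsWithin ?_
      filter_upwards [self_mem_nhdsWithin, mem_nhdsWithin_of_mem_nhds (Iio_mem_nhds h)]
        with y hy hy'
      exact ⟨hy.1, lt_trans hy' one_pos⟩
    · have hx' : x ∈ Ioc (-1 : ℝ) 1 := ⟨by linarith, hx.2⟩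
      refine ((c₁.congr f₁) x hx').mono_of_mem_nhdsWithin ?_
      filter_upwards [self_mem_nhdsWithin, mem_nhdsWithin_of_mem_nhds (Ioi_mem_nhds hx'.1)]
        with y hy hy'
      exact ⟨hy', hy.2⟩
  refine ⟨fun x => √(q x), fun x hx => (hqs x hx).sqrt (hqpos x hx).1.ne', fun x hx => ?_⟩
  obtain ⟨h1, h2⟩ := hqpos x hx
  exact ⟨Real.sqrt_pos.2 h1, by rw [Real.sq_sqrt h1.le, h2]⟩

/-- Half the derivative of `1 - g² = r²(1 - x²)`. It serves to eliminate `r'` from the Gram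
determinant, at the poles as well. -/
theorem mul_derivWithin_eq {g r : ℝ → ℝ} (hg : DifferentiableOn ℝ g (Icc (-1) 1))
    (hr : DifferentiableOn ℝ r (Icc (-1) 1))
    (hrg : ∀ x ∈ Icc (-1 : ℝ) 1, 1 - g x ^ 2 = r x ^ 2 * (1 - x ^ 2)) {x : ℝ}
    (hx : x ∈ Icc (-1 : ℝ) 1) :
    r x * derivWithin r (Icc (-1) 1) x * (1 - x ^ 2) =
      x * r x ^ 2 - g x * derivWithin g (Icc (-1) 1) x := by
  have hu : UniqueDiffWithinAt ℝ (Icc (-1 : ℝ) 1) x := uniqueDiffOn_Icc (by norm_num) x hx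
  have d₁ := (((hg x hx).hasDerivWithinAt.pow 2).const_sub 1)
  have d₂ := ((hr x hx).hasDerivWithinAt.pow 2).mul
    (((hasDerivAt_id x).pow 2).const_sub 1).hasDerivWithinAt
  have e := hu.eq_deriv _ d₁ (d₂.congr (fun y hy => hrg y hy) (hrg x hx))
  simp only [id, Pi.pow_apply] at e
  norm_num at e
  linarith

/-- On the open interval this is the derivative of `cumul_eq` divided by `(1-x²)^(a-1)`. In this
form both sides are continuous on `[-1, 1]`, so the identity extends to the endpoints. -/
theorem rpow_mul_derivWithin_eq (T : IsTransport a ρ₁ ρ₂ g) {r : ℝ → ℝ}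
    (hr : ContinuousOn r (Icc (-1) 1))
    (hrg : ∀ x ∈ Icc (-1 : ℝ) 1, 0 < r x ∧ 1 - g x ^ 2 = r x ^ 2 * (1 - x ^ 2)) {x : ℝ}
    (hx : x ∈ Icc (-1 : ℝ) 1) :
    (r x ^ 2) ^ (a - 1) * derivWithin g (Icc (-1) 1) x * ρ₂ (g x) = ρ₁ x := by
  have hg := T.contDiffOn
  have hU : UniqueDiffOn ℝ (Icc (-1 : ℝ) 1) := uniqueDiffOn_Icc (by norm_num)
  have c₁ : ContinuousOn (fun x => (r x ^ 2) ^ (a - 1) * derivWithin g (Icc (-1) 1) x * ρ₂ (g x))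
      (Icc (-1) 1) := by
    refine ((ContinuousOn.rpow_const (hr.pow 2) fun y hy => Or.inl ?_).mul
      (hg.continuousOn_derivWithin hU (by simp))).mul
      (T.smooth_right.continuous.comp_continuousOn hg.continuousOn)
    exact (pow_pos (hrg y hy).1 2).ne'
  refine Set.EqOn.of_subset_closure (s := Ioo (-1 : ℝ) 1) (fun y hy => ?_) c₁
    T.smooth_left.continuous.continuousOn Ioo_subset_Icc_self
    (by rw [closure_Ioo (by norm_num)]) hx
  have hyI : y ∈ Icc (-1 : ℝ) 1 := ⟨hy.1.le, hy.2.le⟩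
  have hgy := T.mem_Ioo hy
  have hd := ((T.contDiffAt hy).differentiableAt (by simp)).hasDerivAt
  have d₁ := (hasDerivAt_cumul T.exponent_pos T.smooth_right hgy).comp y hd
  have d₂ := hasDerivAt_cumul T.exponent_pos T.smooth_left hy
  have e := d₁.unique (d₂.congr_of_eventuallyEq (by
    filter_upwards [isOpen_Ioo.mem_nhds hy] with z hz
    exact T.cumul_eq z ⟨hz.1.le, hz.2.le⟩))
  rw [wt, wt, (hrg y hyI).2, Real.mul_rpow (sq_nonneg _) (one_sub_sq_pos hy).le] at e
  have hp := Real.rpow_pos_of_pos (one_sub_sq_pos hy) (a - 1)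
  rw [derivWithin_of_mem_nhds (Icc_mem_nhds hy.1 hy.2), ← mul_right_inj' hp.ne', ← e]
  ring

end IsTransport

end VMF

/-! ### Beta and Bessel integrals, normalizing constants -/

namespace VMF

open Filter Topology

section SpecialFunctions

theorem ofReal_beta_integrand {a b t : ℝ} (ht : t ∈ Ioc (0 : ℝ) 1) :
    ((t : ℂ) ^ ((a : ℂ) - 1) * (1 - (t : ℂ)) ^ ((b : ℂ) - 1)) =
      ((t ^ (a - 1) * (1 - t) ^ (b - 1) : ℝ) : ℂ) := by
  rw [Complex.ofReal_mul, Complex.ofReal_cpow ht.1.le, Complex.ofReal_cpow (by linarith [ht.2])]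
  push_cast
  rfl

theorem integrableOn_beta {a b : ℝ} (ha : 0 < a) (hb : 0 < b) :
    IntegrableOn (fun t : ℝ => t ^ (a - 1) * (1 - t) ^ (b - 1)) (Ioc 0 1) := by
  have h := Complex.betaIntegral_convergent (u := a) (v := b) (by simpa) (by simpa)
  rw [intervalIntegrable_iff_integrableOn_Ioc_of_le zero_le_one] at h
  have h' := h.re
  refine IntegrableOn.congr_fun h' (fun t ht => ?_) measurableSet_Ioc
  change (_ : ℂ).re = _
  rw [ofReal_beta_integrand ht]
  simp

theorem integral_beta {a b : ℝ} (ha : 0 < a) (hb : 0 < b) :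
    ∫ t in (0 : ℝ)..1, t ^ (a - 1) * (1 - t) ^ (b - 1) = ProbabilityTheory.beta a b := by
  rw [ProbabilityTheory.beta_eq_betaIntegralReal a b ha hb, Complex.betaIntegral]
  have h : ∫ t in (0 : ℝ)..1, (t : ℂ) ^ ((a : ℂ) - 1) * (1 - (t : ℂ)) ^ ((b : ℂ) - 1) =
      ∫ t in (0 : ℝ)..1, ((t ^ (a - 1) * (1 - t) ^ (b - 1) : ℝ) : ℂ) := by
    refine intervalIntegral.integral_congr_ae (ae_of_all _ fun t ht => ?_)
    rw [uIoc_of_le zero_le_one] at ht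
    exact ofReal_beta_integrand ht
  rw [h, intervalIntegral.integral_ofReal, Complex.ofReal_re]

/-- Substitute `u = t²`. These even moments are what the series of `cosh` requires. -/
theorem integral_pow_mul_one_sub_sq {a : ℝ} (ha : 0 < a) (m : ℕ) :
    ∫ t in (0 : ℝ)..1, t ^ (2 * m) * (1 - t ^ 2) ^ (a - 1) =
      ProbabilityTheory.beta ((m : ℝ) + 1 / 2) a / 2 := by
  have hm : (0 : ℝ) < m + 1 / 2 := by positivity
  set g : ℝ → ℝ := fun u => u ^ ((m : ℝ) + 1 / 2 - 1) * (1 - u) ^ (a - 1) with hg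
  have hgf : ∀ t ∈ Ioc (0 : ℝ) 1, (g ∘ fun t => t ^ 2) t * (2 * t) =
      2 * (t ^ (2 * m) * (1 - t ^ 2) ^ (a - 1)) := by
    intro t ht
    simp only [hg, Function.comp_apply]
    rw [← Real.rpow_natCast t 2, ← Real.rpow_mul ht.1.le, ← Real.rpow_natCast t (2 * m)]
    have : t ^ ((2 * m : ℕ) : ℝ) = t ^ (((2 : ℕ) : ℝ) * ((m : ℝ) + 1 / 2 - 1)) * t := by
      rw [← Real.rpow_add_one ht.1.ne']
      congr 1
      push_cast
      ring
    rw [this]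
    ring
  have himg : (fun t : ℝ => t ^ 2) '' Icc 0 1 ⊆ Icc 0 1 := by
    rintro _ ⟨t, ht, rfl⟩
    exact ⟨by positivity, pow_le_one₀ ht.1 ht.2⟩
  have hI := intervalIntegral.integral_comp_mul_deriv''' (a := 0) (b := 1)
    (f := fun t : ℝ => t ^ 2) (f' := fun t => 2 * t) (g := g) (by fun_prop)
    (fun x _ => by simpa using (hasDerivAt_pow 2 x).hasDerivWithinAt) ?_ ?_ ?_
  · have h1 : ∫ t in (0 : ℝ)..1, (g ∘ fun t => t ^ 2) t * (2 * t) =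
        ∫ t in (0 : ℝ)..1, 2 * (t ^ (2 * m) * (1 - t ^ 2) ^ (a - 1)) :=
      intervalIntegral.integral_congr_ae (ae_of_all _ fun t ht => hgf t
        (by rwa [uIoc_of_le zero_le_one] at ht))
    rw [h1, intervalIntegral.integral_const_mul] at hI
    norm_num at hI
    rw [hg, integral_beta hm ha] at hI
    linarith
  · rintro _ ⟨t, ht, rfl⟩
    rw [min_eq_left zero_le_one, max_eq_right zero_le_one] at ht
    have h1 : 0 < t ^ 2 := pow_pos ht.1 2
    have h2 : 0 < 1 - t ^ 2 := by nlinarith [ht.1, ht.2]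
    refine ContinuousAt.continuousWithinAt (ContinuousAt.mul
      (Real.continuousAt_rpow_const _ _ (Or.inl h1.ne')) ?_)
    exact ContinuousAt.rpow_const (by fun_prop) (Or.inl h2.ne')
  · rw [uIcc_of_le zero_le_one]
    refine IntegrableOn.mono_set ?_ himg
    rw [integrableOn_Icc_iff_integrableOn_Ioc]
    exact integrableOn_beta hm ha
  · rw [uIcc_of_le zero_le_one, integrableOn_Icc_iff_integrableOn_Ioc]
    have h := intervalIntegrable_wt_right (ρ := fun t => 2 * t ^ (2 * m)) ha (by fun_prop)
    rw [intervalIntegrable_iff_integrableOn_Ioc_of_le zero_le_one] at h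
    refine h.congr_fun (fun t ht => ?_) measurableSet_Ioc
    rw [hgf t ht, wt]
    ring

theorem cumul_pow_one {a : ℝ} (ha : 0 < a) (m : ℕ) :
    cumul a (fun t => t ^ (2 * m)) 1 = ProbabilityTheory.beta ((m : ℝ) + 1 / 2) a := by
  have hz : (0 : ℝ) ∈ Icc (-1 : ℝ) 1 := by norm_num
  have hρ : Continuous fun t : ℝ => t ^ (2 * m) := by fun_prop
  have h1 : ∫ t in (-1 : ℝ)..0, wt a (fun t => t ^ (2 * m)) t =
      ∫ t in (0 : ℝ)..1, wt a (fun t => t ^ (2 * m)) t := by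
    have h := intervalIntegral.integral_comp_neg (a := (0 : ℝ)) (b := 1)
      (fun t => wt a (fun t => t ^ (2 * m)) t)
    rw [neg_zero] at h
    rw [← h]
    simp [wt_neg]
  rw [cumul, ← intervalIntegral.integral_add_adjacent_intervals
    (intervalIntegrable_wt ha hρ left_mem hz) (intervalIntegrable_wt ha hρ hz right_mem), h1]
  simp only [wt, mul_comm _ (_ ^ (2 * m))]
  rw [integral_pow_mul_one_sub_sq ha m]
  ring

/-- The factor `(1-t²)^(a-1)` is even, so the odd part of the exponential integrates to zero. -/
theorem cumul_exp_eq_cumul_cosh {a : ℝ} (ha : 0 < a) (κ : ℝ) :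
    cumul a (fun t => Real.exp (κ * t)) 1 = cumul a (fun t => Real.cosh (κ * t)) 1 := by
  have h1 := cumul_neg (a := a) (ρ := fun t => Real.exp (κ * t)) ha (by fun_prop) right_mem
  rw [cumul_left, sub_zero] at h1
  have h2 : cumul a (fun t => Real.cosh (κ * t)) 1 =
      (cumul a (fun t => Real.exp (κ * t)) 1 + cumul a (fun t => Real.exp (κ * -t)) 1) / 2 := by
    simp only [cumul]
    rw [← intervalIntegral.integral_add (intervalIntegrable_wt ha (by fun_prop) left_mem right_mem)
      (intervalIntegrable_wt ha (by fun_prop) left_mem right_mem),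
      ← intervalIntegral.integral_div]
    refine intervalIntegral.integral_congr fun t _ => ?_
    simp only [wt, Real.cosh_eq, mul_neg]
    ring
  rw [h2, h1]
  ring

/-- Poisson's integral for the modified Bessel function. -/
theorem cumul_exp_one {a κ : ℝ} (ha : 0 < a) (hκ : 0 < κ) :
    cumul a (fun t => Real.exp (κ * t)) 1 =
      besselI (a - 1 / 2) κ * √Real.pi * Real.Gamma a * (2 / κ) ^ (a - 1 / 2) := by
  rw [cumul_exp_eq_cumul_cosh ha]
  -- The `cosh` series is integrated term by term; since `|t| ≤ 1`, its coefficients at `κ` times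
  -- the bare weight dominate.
  have hS : HasSum (fun m : ℕ => ∫ t in (-1 : ℝ)..1,
      κ ^ (2 * m) / ((2 * m).factorial : ℝ) * wt a (fun t => t ^ (2 * m)) t)
      (cumul a (fun t => Real.cosh (κ * t)) 1) := by
    refine intervalIntegral.hasSum_integral_of_dominated_convergence
      (fun m t => κ ^ (2 * m) / ((2 * m).factorial : ℝ) * wt a (fun _ => 1) t) ?_ ?_ ?_ ?_ ?_
    · intro m
      have h := intervalIntegrable_wt (ρ := fun t => t ^ (2 * m)) ha (by fun_prop) left_mem right_mem
      exact (h.const_mul _).def'.aestronglyMeasurable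
    · refine fun m => ae_of_all _ fun t ht => ?_
      rw [uIoc_of_le (by norm_num)] at ht
      have h1 : |t| ^ (2 * m) ≤ 1 := pow_le_one₀ (abs_nonneg _) (abs_le.2 ⟨ht.1.le, ht.2⟩)
      have h2 : 0 ≤ (1 - t ^ 2) ^ (a - 1) := Real.rpow_nonneg (by nlinarith [ht.1, ht.2]) _
      have h3 : 0 ≤ κ ^ (2 * m) / ((2 * m).factorial : ℝ) := by positivity
      rw [Real.norm_eq_abs, abs_mul, abs_of_nonneg h3, wt, wt, abs_mul, abs_of_nonneg h2, abs_pow]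
      gcongr
    · exact ae_of_all _ fun t _ => (Real.hasSum_cosh κ).summable.mul_right _
    · simp only [tsum_mul_right]
      exact (intervalIntegrable_wt ha (by fun_prop) left_mem right_mem).const_mul _
    · refine ae_of_all _ fun t _ => ?_
      have h := (Real.hasSum_cosh (κ * t)).mul_left ((1 - t ^ 2) ^ (a - 1))
      refine h.congr_fun fun m => ?_
      rw [wt, mul_pow]
      ring
  rw [← hS.tsum_eq, besselI, ← tsum_mul_right, ← tsum_mul_right, ← tsum_mul_right]
  refine tsum_congr fun m => ?_
  rw [intervalIntegral.integral_const_mul]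
  change _ * cumul a (fun t => t ^ (2 * m)) 1 = _
  rw [cumul_pow_one ha, ProbabilityTheory.beta]
  -- Duplication at `m + 1/2` gives `Γ(m + 1/2) / (2m)! = √π / (4^m m!)`, which turns the moments
  -- into the terms of the Bessel series.
  have hd := Real.Gamma_mul_Gamma_add_half ((m : ℝ) + 1 / 2)
  rw [show (m : ℝ) + 1 / 2 + 1 / 2 = m + 1 by ring, show 2 * ((m : ℝ) + 1 / 2) = (2 * m : ℕ) + 1 by
    push_cast; ring, Real.Gamma_nat_eq_factorial, Real.Gamma_nat_eq_factorial] at hd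
  have h1 : (2 : ℝ) ^ (1 - (((2 * m : ℕ) : ℝ) + 1)) = ((2 : ℝ) ^ (2 * m))⁻¹ := by
    rw [← Real.rpow_natCast, ← Real.rpow_neg two_pos.le]
    congr 1
    ring
  rw [h1] at hd
  have h2 : (κ / 2) ^ (2 * (m : ℝ) + (a - 1 / 2)) * (2 / κ) ^ (a - 1 / 2) = κ ^ (2 * m) / 2 ^ (2 * m) := by
    have hk : 0 < κ / 2 := by positivity
    rw [show 2 / κ = (κ / 2)⁻¹ by rw [inv_div], Real.inv_rpow hk.le, Real.rpow_add hk,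
      mul_inv_cancel_right₀ (Real.rpow_pos_of_pos hk _).ne',
      show 2 * (m : ℝ) = ((2 * m : ℕ) : ℝ) by push_cast; ring, Real.rpow_natCast, div_pow]
  have h3 : 0 < Real.Gamma ((m : ℝ) + 1 / 2 + a) := Real.Gamma_pos_of_pos (by positivity)
  rw [show (m : ℝ) + (a - 1 / 2) + 1 = m + 1 / 2 + a by ring]
  have h4 : (0 : ℝ) < ((2 * m).factorial : ℝ) := by positivity
  have h5 : (0 : ℝ) < (m.factorial : ℝ) := by positivity
  rw [← eq_div_iff h5.ne'] at hd
  rw [hd]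
  calc _ = κ ^ (2 * m) / 2 ^ (2 * m) * (√Real.pi * Real.Gamma a /
        (m.factorial * Real.Gamma ((m : ℝ) + 1 / 2 + a))) := by
        field_simp
    _ = _ := by
        rw [← h2]
        ring

/-- Poisson's integral is positive, and so are the other factors of its closed form. -/
theorem besselI_pos {a κ : ℝ} (ha : 0 < a) (hκ : 0 < κ) : 0 < besselI (a - 1 / 2) κ := by
  have h := strictMonoOn_cumul (a := a) (ρ := fun t => Real.exp (κ * t)) ha (by fun_prop)
    (fun t => Real.exp_pos _) left_mem right_mem (by norm_num)
  rw [cumul_left, cumul_exp_one ha hκ] at h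
  have h1 := Real.Gamma_pos_of_pos ha
  have h2 : 0 < (2 / κ) ^ (a - 1 / 2) := Real.rpow_pos_of_pos (by positivity) _
  have h3 := Real.sqrt_pos.2 Real.pi_pos
  exact pos_of_mul_pos_left (pos_of_mul_pos_left (pos_of_mul_pos_left h h2.le) h1.le) h3.le

theorem cumul_const_mul {a c x : ℝ} {ρ : ℝ → ℝ} :
    cumul a (fun t => c * ρ t) x = c * cumul a ρ x := by
  simp only [cumul, ← intervalIntegral.integral_const_mul, wt]
  congr 1
  ext t
  ring

end SpecialFunctions

noncomputable section

/-- The constant factor of the weight `wt (n/2) (fun _ => uConst n)` whose mass function is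
`U (n + 1)`. -/
def uConst (n : ℕ) : ℝ := 2 ^ (1 - (n : ℝ)) / ProbabilityTheory.beta (n / 2) (n / 2)

/-- The constant factor of the weight `wt (n/2) (fun t => fConst n κ * exp (κ * t))` whose mass
function is `F (n + 1) κ`. -/
def fConst (n : ℕ) (κ : ℝ) : ℝ :=
  (besselI ((n : ℝ) / 2 - 1 / 2) κ * √Real.pi * Real.Gamma (n / 2) *
    (2 / κ) ^ ((n : ℝ) / 2 - 1 / 2))⁻¹

end

variable {n : ℕ} {κ : ℝ}

theorem half_pos_of_one_le (hn : 1 ≤ n) : (0 : ℝ) < n / 2 := by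
  have : (1 : ℝ) ≤ n := by exact_mod_cast hn
  linarith

theorem uConst_pos (hn : 1 ≤ n) : 0 < uConst n :=
  div_pos (Real.rpow_pos_of_pos two_pos _)
    (ProbabilityTheory.beta_pos (half_pos_of_one_le hn) (half_pos_of_one_le hn))

theorem fConst_pos (hn : 1 ≤ n) (hκ : 0 < κ) : 0 < fConst n κ := by
  have ha := half_pos_of_one_le hn
  have h1 := besselI_pos ha hκ
  have h2 := Real.Gamma_pos_of_pos ha
  have h3 : 0 < (2 / κ) ^ ((n : ℝ) / 2 - 1 / 2) := Real.rpow_pos_of_pos (by positivity) _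
  have h4 := Real.sqrt_pos.2 Real.pi_pos
  rw [fConst]
  positivity

/-- With `t = (s + 1)/2` one has `t(1 - t) = (1 - s²)/4` and `dt = ds/2`; hence the constant
`4^(1-n/2)/2 = 2^(1-n)`. -/
theorem U_eq_cumul {x : ℝ} (hx : x ∈ Icc (-1 : ℝ) 1) :
    U (n + 1) x = cumul (n / 2) (fun _ => uConst n) x := by
  have h1 : ∫ s in (-1 : ℝ)..x, (1 / 2 * s + 1 / 2) ^ ((n : ℝ) / 2 - 1) *
      (1 - (1 / 2 * s + 1 / 2)) ^ ((n : ℝ) / 2 - 1) =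
      2 * ∫ t in (0 : ℝ)..((x + 1) / 2), t ^ ((n : ℝ) / 2 - 1) * (1 - t) ^ ((n : ℝ) / 2 - 1) := by
    rw [intervalIntegral.integral_comp_mul_add (fun t : ℝ => t ^ ((n : ℝ) / 2 - 1) *
      (1 - t) ^ ((n : ℝ) / 2 - 1)) (by norm_num : (1 / 2 : ℝ) ≠ 0) (1 / 2)]
    norm_num
    congr 1
    ring
  have h2 : ∫ s in (-1 : ℝ)..x, (1 / 2 * s + 1 / 2) ^ ((n : ℝ) / 2 - 1) *
      (1 - (1 / 2 * s + 1 / 2)) ^ ((n : ℝ) / 2 - 1) =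
      ∫ s in (-1 : ℝ)..x, (1 / 4) ^ ((n : ℝ) / 2 - 1) * wt (n / 2) (fun _ => 1) s := by
    refine intervalIntegral.integral_congr fun s hs => ?_
    rw [uIcc_of_le hx.1] at hs
    have := hx.2
    simp only [wt]
    rw [← Real.mul_rpow (by linarith [hs.1]) (by linarith [hs.2]), mul_one,
      ← Real.mul_rpow (by norm_num) (by nlinarith [hs.1, hs.2])]
    congr 1
    ring
  rw [h1, intervalIntegral.integral_const_mul] at h2
  have h3 : cumul (n / 2) (fun _ => uConst n) x = uConst n * cumul (n / 2) (fun _ => 1) x := by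
    rw [← cumul_const_mul]
    simp
  rw [h3, U, regIncBeta, uConst]
  have e : (((n + 1 : ℕ) : ℝ) - 1) / 2 = n / 2 := by push_cast; ring
  have h4 : (2 : ℝ) ^ (1 - (n : ℝ)) = (1 / 4) ^ ((n : ℝ) / 2 - 1) / 2 := by
    rw [show (1 / 4 : ℝ) = 2 ^ (-2 : ℝ) by
      rw [Real.rpow_neg two_pos.le, Real.rpow_two]; norm_num, ← Real.rpow_mul two_pos.le,
      ← Real.rpow_sub_one two_pos.ne']
    congr 1
    ring
  change _ = (1 / 4) ^ ((n : ℝ) / 2 - 1) * cumul (n / 2) (fun _ => 1) x at h2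
  rw [e, h4, div_mul_eq_mul_div, div_mul_eq_mul_div, ← h2]
  ring

theorem U_one (hn : 1 ≤ n) : U (n + 1) 1 = 1 := by
  have e : (((n + 1 : ℕ) : ℝ) - 1) / 2 = n / 2 := by push_cast; ring
  have ha := half_pos_of_one_le hn
  rw [U, regIncBeta, e, show ((1 : ℝ) + 1) / 2 = 1 by norm_num, integral_beta ha ha,
    div_self (ProbabilityTheory.beta_pos ha ha).ne']

theorem F_eq_cumul (x : ℝ) :
    F (n + 1) κ x = cumul (n / 2) (fun t => fConst n κ * Real.exp (κ * t)) x := by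
  rw [cumul_const_mul, F, fConst, div_eq_inv_mul, cumul]
  have e₁ : ((n + 1 : ℕ) : ℝ) / 2 - 1 = n / 2 - 1 / 2 := by push_cast; ring
  have e₂ : (((n + 1 : ℕ) : ℝ) - 1) / 2 = n / 2 := by push_cast; ring
  have e₃ : (((n + 1 : ℕ) : ℝ) - 3) / 2 = n / 2 - 1 := by push_cast; ring
  rw [e₁, e₂, e₃]
  simp only [wt, mul_comm (Real.exp _)]

theorem F_one (hn : 1 ≤ n) (hκ : 0 < κ) : F (n + 1) κ 1 = 1 := by
  have h := fConst_pos hn hκ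
  rw [F_eq_cumul, cumul_const_mul, cumul_exp_one (half_pos_of_one_le hn) hκ]
  rw [fConst] at h ⊢
  exact inv_mul_cancel₀ (inv_pos.1 h).ne'

theorem surfaceMeasure_real_univ (n : ℕ) : (surfaceMeasure n).real univ =
    2 * Real.pi ^ (((n : ℝ) + 1) / 2) / Real.Gamma (((n : ℝ) + 1) / 2) := by
  have hp : (0 : ℝ) < ((n : ℝ) + 1) / 2 := by positivity
  have hG := Real.Gamma_pos_of_pos hp
  rw [surfaceMeasure, Measure.toSphere_real_apply_univ, measureReal_def, EuclideanSpace.volume_ball]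
  simp only [finrank_euclideanSpace, Fintype.card_fin, ENNReal.ofReal_one, one_pow, one_mul]
  push_cast
  rw [Real.Gamma_add_one hp.ne', ENNReal.toReal_ofReal (by positivity), Real.sqrt_eq_rpow,
    ← Real.rpow_natCast, ← Real.rpow_mul Real.pi_pos.le]
  push_cast
  rw [show 1 / 2 * ((n : ℝ) + 1) = (n + 1) / 2 by ring]
  field_simp

/-- The normalizing constants of the two weights and of the two densities match. -/
theorem inv_surface_mul_fConst_div_uConst (hn : 1 ≤ n) (hκ : 0 < κ) :
    ((surfaceMeasure n).real univ)⁻¹ * (fConst n κ / uConst n) =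
      κ ^ (((n + 1 : ℕ) : ℝ) / 2 - 1) /
      ((2 * Real.pi) ^ (((n + 1 : ℕ) : ℝ) / 2) * besselI (((n + 1 : ℕ) : ℝ) / 2 - 1) κ) := by
  have ha := half_pos_of_one_le hn
  have e₁ : ((n + 1 : ℕ) : ℝ) / 2 - 1 = n / 2 - 1 / 2 := by push_cast; ring
  have e₂ : ((n + 1 : ℕ) : ℝ) / 2 = n / 2 + 1 / 2 := by push_cast; ring
  -- Duplication at `n/2` relates `Γ(n/2)` and `Γ((n+1)/2)` to the `Γ(n)` of the Beta function; the
  -- rest is bookkeeping of powers.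
  have hd := Real.Gamma_mul_Gamma_add_half ((n : ℝ) / 2)
  have g₁ := Real.Gamma_pos_of_pos ha
  have g₂ : 0 < Real.Gamma ((n : ℝ) / 2 + 1 / 2) := Real.Gamma_pos_of_pos (by positivity)
  have g₃ : 0 < Real.Gamma (n : ℝ) := Real.Gamma_pos_of_pos (by linarith)
  have hI := besselI_pos ha hκ
  have hs := Real.sqrt_pos.2 Real.pi_pos
  have ht : (0 : ℝ) < 2 ^ (1 - (n : ℝ)) := Real.rpow_pos_of_pos two_pos _
  rw [mul_div_cancel₀ (n : ℝ) two_ne_zero] at hd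
  rw [surfaceMeasure_real_univ, fConst, uConst, ProbabilityTheory.beta, add_halves, e₁, e₂,
    show ((n : ℝ) + 1) / 2 = n / 2 + 1 / 2 by ring, Real.mul_rpow two_pos.le Real.pi_pos.le,
    Real.div_rpow two_pos.le hκ.le]
  have hk : 0 < κ ^ ((n : ℝ) / 2 - 1 / 2) := Real.rpow_pos_of_pos hκ _
  have hp : 0 < Real.pi ^ ((n : ℝ) / 2 + 1 / 2) := Real.rpow_pos_of_pos Real.pi_pos _
  have h2 : (2 : ℝ) ^ ((n : ℝ) / 2 + 1 / 2) = 2 * 2 ^ ((n : ℝ) / 2 - 1 / 2) := by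
    rw [mul_comm, ← Real.rpow_add_one two_ne_zero]
    congr 1
    ring
  have h3 : (0 : ℝ) < 2 ^ ((n : ℝ) / 2 - 1 / 2) := Real.rpow_pos_of_pos two_pos _
  rw [h2]
  generalize besselI ((n : ℝ) / 2 - 1 / 2) κ = B at *
  generalize Real.Gamma ((n : ℝ) / 2 + 1 / 2) = G at *
  generalize Real.Gamma ((n : ℝ) / 2) = G' at *
  generalize κ ^ ((n : ℝ) / 2 - 1 / 2) = K at *
  generalize (2 : ℝ) ^ ((n : ℝ) / 2 - 1 / 2) = K' at *
  generalize Real.pi ^ ((n : ℝ) / 2 + 1 / 2) = P at *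
  field_simp
  linear_combination hd

end VMF

/-! ### Gram determinants -/

namespace VMF

open Filter Topology

section Determinant

variable {V : Type*} [NormedAddCommGroup V] [InnerProductSpace ℝ V] [FiniteDimensional ℝ V]

theorem det_adjoint_eq (A : V →ₗ[ℝ] V) : LinearMap.det (LinearMap.adjoint A) = LinearMap.det A := by
  let b := stdOrthonormalBasis ℝ V
  rw [← LinearMap.det_toMatrix b.toBasis, LinearMap.toMatrix_adjoint, Matrix.det_conjTranspose,
    LinearMap.det_toMatrix]
  simp

/-- If `A x` is a unit vector orthogonal to the image of `x^⊥`, then `|det A|` is the Gram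
determinant of the restriction of `A` to `x^⊥`. -/
theorem abs_det_eq_sqrt_det_adjoint_comp (A : V →L[ℝ] V) {x : V} (hx : ‖x‖ = 1) (hAx : ‖A x‖ = 1)
    {K : Submodule ℝ V} (hK : K = (ℝ ∙ x)ᗮ) (horth : ∀ v ∈ K, ⟪A x, A v⟫ = 0) {B : K →L[ℝ] V}
    (hB : B = A ∘L K.subtypeL) :
    |A.det| = √(LinearMap.det
      ((ContinuousLinearMap.adjoint B ∘L B : K →L[ℝ] K) : K →ₗ[ℝ] K)) := by
  set S : K →ₗ[ℝ] K := ((ContinuousLinearMap.adjoint B ∘L B : K →L[ℝ] K) : K →ₗ[ℝ] K) with hS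
  set M : V →ₗ[ℝ] V := ((ContinuousLinearMap.adjoint A ∘L A : V →L[ℝ] V) : V →ₗ[ℝ] V) with hM
  have hdetA : A.det ^ 2 = LinearMap.det M := by
    have h1 : M = (LinearMap.adjoint (A : V →ₗ[ℝ] V)) ∘ₗ (A : V →ₗ[ℝ] V) := by
      ext v
      refine ext_inner_right ℝ fun w => ?_
      simp [hM, ContinuousLinearMap.adjoint_inner_left, LinearMap.adjoint_inner_left]
    rw [h1, LinearMap.det_comp, det_adjoint_eq, ContinuousLinearMap.det]
    simp [sq]
  have hinner : ∀ v w, ⟪M v, w⟫ = ⟪A v, A w⟫ := fun v w => by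
    simp [hM, ContinuousLinearMap.adjoint_inner_left]
  have hdecomp : ∀ w : V, ∃ c : ℝ, ∃ u : K, w = c • x + u := fun w => by
    obtain ⟨y, hy, z, hz, rfl⟩ := (ℝ ∙ x).exists_add_mem_mem_orthogonal w
    obtain ⟨c, rfl⟩ := Submodule.mem_span_singleton.1 hy
    exact ⟨c, ⟨z, hK ▸ hz⟩, rfl⟩
  have hxK : ∀ u : K, ⟪x, (u : V)⟫ = 0 := fun u =>
    Submodule.mem_orthogonal_singleton_iff_inner_right.1 (hK ▸ u.2)
  have hxx : ⟪x, x⟫ = 1 := by rw [real_inner_self_eq_norm_sq, hx, one_pow]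
  -- `M = AᵀA` fixes `x` and acts on `x^⊥` as the Gram operator `S`, so it is block diagonal and
  -- `det M = det S`.
  have hMx : M x = x := by
    refine ext_inner_right ℝ fun w => ?_
    obtain ⟨c, u, rfl⟩ := hdecomp w
    rw [hinner, map_add, map_smul, inner_add_right, inner_add_right, inner_smul_right,
      inner_smul_right, horth _ u.2, hxK, hxx, real_inner_self_eq_norm_sq, hAx, one_pow]
  have hMK : ∀ v : K, M v = (S v : V) := by
    intro v
    refine ext_inner_right ℝ fun w => ?_
    obtain ⟨c, u, rfl⟩ := hdecomp w
    have h1 : ⟪(S v : V), (u : V)⟫ = ⟪A v, A u⟫ := by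
      have : ⟪S v, u⟫ = ⟪B v, B u⟫ := by
        simp [hS, ContinuousLinearMap.adjoint_inner_left]
      rw [Submodule.coe_inner] at this
      rw [this, hB]
      rfl
    rw [hinner, map_add, map_smul, inner_add_right, inner_add_right, inner_smul_right,
      inner_smul_right, real_inner_comm, horth _ v.2, real_inner_comm x, hxK, h1]
  have hc : IsCompl K (ℝ ∙ x) := hK ▸ (Submodule.isCompl_orthogonal (ℝ ∙ x)).symm
  have hconj : M = (Submodule.prodEquivOfIsCompl K (ℝ ∙ x) hc : (K × (ℝ ∙ x)) →ₗ[ℝ] V) ∘ₗ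
      (S.prodMap LinearMap.id) ∘ₗ
      ((Submodule.prodEquivOfIsCompl K (ℝ ∙ x) hc).symm : V →ₗ[ℝ] (K × (ℝ ∙ x))) := by
    ext v
    obtain ⟨⟨k, y, hy⟩, rfl⟩ := (Submodule.prodEquivOfIsCompl K (ℝ ∙ x) hc).surjective v
    obtain ⟨d, rfl⟩ := Submodule.mem_span_singleton.1 hy
    rw [LinearMap.comp_apply, LinearMap.comp_apply, LinearEquiv.coe_coe, LinearEquiv.coe_coe,
      LinearEquiv.symm_apply_apply, LinearMap.prodMap_apply, Submodule.coe_prodEquivOfIsCompl',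
      Submodule.coe_prodEquivOfIsCompl', map_add, hMK, map_smul, hMx, LinearMap.id_apply]
  have hdetM : LinearMap.det M = LinearMap.det S := by
    rw [hconj, LinearMap.det_conj, LinearMap.det_prodMap, LinearMap.det_id, mul_one]
  rw [← hdetM, ← hdetA, Real.sqrt_sq_eq_abs]

/-- The determinant of a rank-one perturbation of a multiple of the identity. -/
theorem det_eq_of_inner_eq {q c : ℝ} (hq : q ≠ 0) (e : V) (S : V →ₗ[ℝ] V)
    (hS : ∀ v w, ⟪S v, w⟫ = q * ⟪v, w⟫ + c * ⟪e, v⟫ * ⟪e, w⟫) :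
    LinearMap.det S = q ^ Module.finrank ℝ V * (1 + c / q * ‖e‖ ^ 2) := by
  -- `S = q (1 + (c/q) e ⊗ e)`, a multiple of a transvection in the general sense, whose determinant
  -- is one plus the form evaluated at the vector.
  have h1 : S = q • LinearMap.transvection (innerₛₗ ℝ e) ((c / q) • e) := by
    ext v
    refine ext_inner_right ℝ fun w => ?_
    rw [hS]
    simp [LinearMap.transvection.apply, inner_add_left, inner_smul_left]
    field_simp
  rw [h1, LinearMap.det_smul, LinearMap.transvection.det]
  simp
end Determinant

end VMF

/-! ### Change of variables on the sphere -/

namespace VMF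

open Filter Topology
open scoped Pointwise

variable {n : ℕ}

theorem norm_coe_sph (x : Sph n) : ‖(x : Amb n)‖ = 1 := by simp

theorem coe_sph_ne_zero (x : Sph n) : (x : Amb n) ≠ 0 := by
  rw [← norm_ne_zero_iff, norm_coe_sph]; exact one_ne_zero

noncomputable section

open Classical in
/-- The radial projection to the unit sphere. -/
def radialProj (n : ℕ) (y : Amb n) : Sph n :=
  ⟨if y = 0 then northPole n else ‖y‖⁻¹ • y, by
    split_ifs with h
    · exact (northPole n).2
    · simp [norm_smul, h]⟩

/-- The extension of a self-map of the sphere to the ambient space that is homogeneous of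
degree one. -/
def coneExt (n : ℕ) (f : Sph n → Sph n) (y : Amb n) : Amb n := ‖y‖ • radialExt n f y

end

theorem coe_radialProj {y : Amb n} (hy : y ≠ 0) : (radialProj n y : Amb n) = ‖y‖⁻¹ • y := by
  simp [radialProj, hy]

theorem norm_smul_radialProj {y : Amb n} (hy : y ≠ 0) : ‖y‖ • (radialProj n y : Amb n) = y := by
  rw [coe_radialProj hy, smul_inv_smul₀ (norm_ne_zero_iff.2 hy)]

theorem radialExt_of_ne {f : Sph n → Sph n} {y : Amb n} (hy : y ≠ 0) :
    radialExt n f y = f (radialProj n y) := by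
  simp [radialExt, radialProj, hy]

theorem radialProj_smul {c : ℝ} (hc : 0 < c) (x : Sph n) :
    radialProj n (c • (x : Amb n)) = x := by
  apply Subtype.ext
  rw [coe_radialProj (smul_ne_zero hc.ne' (coe_sph_ne_zero x)), norm_smul, norm_coe_sph, mul_one,
    Real.norm_of_nonneg hc.le, inv_smul_smul₀ hc.ne']

theorem radialExt_smul {f : Sph n → Sph n} {c : ℝ} (hc : 0 < c) (x : Sph n) :
    radialExt n f (c • (x : Amb n)) = f x := by
  rw [radialExt_of_ne (smul_ne_zero hc.ne' (coe_sph_ne_zero x)), radialProj_smul hc]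

theorem radialExt_coe {f : Sph n → Sph n} (x : Sph n) : radialExt n f x = f x := by
  simpa using radialExt_smul (f := f) one_pos x

theorem measurable_radialProj : Measurable (radialProj n) := by
  classical
  refine Measurable.subtype_mk ?_
  exact Measurable.ite (measurableSet_singleton 0) measurable_const (by fun_prop)

/-- `toSphere` measures `s` by the volume of the cone over it. Writing the cone as a preimage
exhibits surface measure as a push-forward under radial projection. -/
theorem Ioo_smul_image_coe (s : Set (Sph n)) :
    Ioo (0 : ℝ) 1 • ((↑) '' s : Set (Amb n)) = radialProj n ⁻¹' s ∩ (ball 0 1 \ {0}) := by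
  ext y
  constructor
  · rintro ⟨c, hc, _, ⟨x, hx, rfl⟩, rfl⟩
    refine ⟨by simpa only [mem_preimage, radialProj_smul hc.1] using hx, ?_,
      smul_ne_zero hc.1.ne' (coe_sph_ne_zero x)⟩
    simpa [norm_smul, abs_of_pos hc.1] using hc.2
  · rintro ⟨hys, hyb, hy0⟩
    exact ⟨‖y‖, ⟨norm_pos_iff.2 hy0, by simpa using hyb⟩, radialProj n y, ⟨_, hys, rfl⟩,
      norm_smul_radialProj hy0⟩

theorem surfaceMeasure_eq_map (n : ℕ) : surfaceMeasure n =
    ((n + 1 : ℕ) : ℝ≥0∞) •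
      ((volume : Measure (Amb n)).restrict (ball 0 1 \ {0})).map (radialProj n) := by
  ext s hs
  rw [surfaceMeasure, Measure.toSphere_apply' _ hs, Measure.smul_apply,
    Measure.map_apply measurable_radialProj hs, Measure.restrict_apply (measurable_radialProj hs),
    Ioo_smul_image_coe, smul_eq_mul, finrank_euclideanSpace, Fintype.card_fin]

theorem hasFDerivAt_norm_sph (x : Sph n) :
    HasFDerivAt (fun y : Amb n => ‖y‖) (innerSL ℝ (x : Amb n)) x := by
  have h := ((hasStrictFDerivAt_norm_sq (x : Amb n)).hasFDerivAt).sqrt (by simp)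
  simp only [Real.sqrt_sq (norm_nonneg _)] at h
  refine h.congr_fderiv ?_
  ext v
  simp

section Derivative

variable {f : Sph n → Sph n} {x : Sph n}

theorem fderiv_radialExt_self (hf : DifferentiableAt ℝ (radialExt n f) x) :
    fderiv ℝ (radialExt n f) x (x : Amb n) = 0 := by
  have h1 : HasDerivAt (fun t : ℝ => t • (x : Amb n)) (x : Amb n) 1 := by
    simpa using (hasDerivAt_id (1 : ℝ)).smul_const (x : Amb n)
  have h2 : HasDerivAt (fun t : ℝ => radialExt n f (t • (x : Amb n)))
      (fderiv ℝ (radialExt n f) x (x : Amb n)) 1 := by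
    refine HasFDerivAt.comp_hasDerivAt (1 : ℝ) (l := radialExt n f) ?_ h1
    simpa using hf.hasFDerivAt
  refine h2.unique ((hasDerivAt_const (1 : ℝ) (f x : Amb n)).congr_of_eventuallyEq ?_)
  filter_upwards [Ioi_mem_nhds (one_pos : (0 : ℝ) < 1)] with t ht
  exact radialExt_smul ht x

theorem inner_fderiv_radialExt (hf : DifferentiableAt ℝ (radialExt n f) x) (v : Amb n) :
    ⟪(f x : Amb n), fderiv ℝ (radialExt n f) x v⟫ = 0 := by
  have h1 := hf.hasFDerivAt.norm_sq
  have h2 : HasFDerivAt (fun y => ‖radialExt n f y‖ ^ 2) (0 : Amb n →L[ℝ] ℝ) (x : Amb n) := by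
    refine (hasFDerivAt_const (1 : ℝ) (x : Amb n)).congr_of_eventuallyEq ?_
    filter_upwards [isOpen_compl_singleton.mem_nhds (coe_sph_ne_zero x)] with y hy
    rw [radialExt_of_ne hy, norm_coe_sph, one_pow]
  have h3 := congrArg (fun L : Amb n →L[ℝ] ℝ => L v) (h1.unique h2)
  simpa [radialExt_coe] using h3

theorem hasFDerivAt_coneExt (hf : DifferentiableAt ℝ (radialExt n f) x) :
    HasFDerivAt (coneExt n f)
      (fderiv ℝ (radialExt n f) x + (innerSL ℝ (x : Amb n)).smulRight (f x : Amb n)) x := by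
  have h1 := hasFDerivAt_norm_sph x
  refine (h1.smul hf.hasFDerivAt).congr_fderiv ?_
  rw [norm_coe_sph, one_smul, radialExt_coe]

theorem coneExt_smul {c : ℝ} (hc : 0 < c) (y : Amb n) : coneExt n f (c • y) = c • coneExt n f y := by
  rcases eq_or_ne y 0 with rfl | hy
  · simp [coneExt]
  · conv_lhs => rw [← norm_smul_radialProj hy, smul_smul]
    have hc' : 0 < c * ‖y‖ := mul_pos hc (norm_pos_iff.2 hy)
    rw [coneExt, radialExt_smul hc', norm_smul, norm_coe_sph, mul_one, Real.norm_of_nonneg hc'.le,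
      coneExt, radialExt_of_ne hy, smul_smul]

/-- The derivative of a map homogeneous of degree one is constant along rays, so its determinant on
the punctured ball depends on the direction alone. -/
theorem hasFDerivAt_coneExt_smul {A : Amb n →L[ℝ] Amb n} {y : Amb n}
    (hA : HasFDerivAt (coneExt n f) A y) {c : ℝ} (hc : 0 < c) :
    HasFDerivAt (coneExt n f) A (c • y) := by
  have h1 : HasFDerivAt (fun w : Amb n => c⁻¹ • w) (c⁻¹ • ContinuousLinearMap.id ℝ (Amb n))
      (c • y) := (hasFDerivAt_id _).const_smul c⁻¹
  have h2 : HasFDerivAt (fun w => c • coneExt n f (c⁻¹ • w))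
      (c • (A ∘L (c⁻¹ • ContinuousLinearMap.id ℝ (Amb n)))) (c • y) := by
    refine (HasFDerivAt.comp (c • y) (g := coneExt n f) ?_ h1).const_smul c
    rwa [inv_smul_smul₀ hc.ne']
  refine (h2.congr_fderiv ?_).congr_of_eventuallyEq (Eventually.of_forall fun w => ?_)
  · ext v
    simp [smul_smul, hc.ne']
  · simp only
    rw [coneExt_smul (inv_pos.2 hc), smul_inv_smul₀ hc.ne']

/-- The derivative of the cone map sends `x` to the unit vector `f x` and agrees on `x^⊥` with that
of the radial extension, whose image is orthogonal to `f x` because the extension has norm one. The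
radial direction therefore contributes a factor 1. -/
theorem abs_det_fderiv_coneExt (hf : DifferentiableAt ℝ (radialExt n f) x) :
    |(fderiv ℝ (radialExt n f) x + (innerSL ℝ (x : Amb n)).smulRight (f x : Amb n)).det| =
      densityUpdate n f x := by
  have hx : (fderiv ℝ (radialExt n f) x + (innerSL ℝ (x : Amb n)).smulRight (f x : Amb n))
      (x : Amb n) = f x := by
    simp [fderiv_radialExt_self hf]
  have hv : ∀ v ∈ (ℝ ∙ (x : Amb n))ᗮ,
      (fderiv ℝ (radialExt n f) x + (innerSL ℝ (x : Amb n)).smulRight (f x : Amb n)) v =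
        fderiv ℝ (radialExt n f) x v := by
    intro v hv
    have := Submodule.mem_orthogonal_singleton_iff_inner_right.1 hv
    simp [this]
  refine abs_det_eq_sqrt_det_adjoint_comp _ (norm_coe_sph x) (by rw [hx, norm_coe_sph]) rfl
    (fun v hvK => ?_) ?_
  · rw [hx, hv v hvK, inner_fderiv_radialExt hf]
  · ext1 v
    exact (hv v v.2).symm

end Derivative

theorem coneExt_of_ne {f : Sph n → Sph n} {y : Amb n} (hy : y ≠ 0) :
    coneExt n f y = ‖y‖ • (f (radialProj n y) : Amb n) := by
  rw [coneExt, radialExt_of_ne hy]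

theorem injOn_coneExt {f : Sph n → Sph n} (hf : Function.Injective f) :
    InjOn (coneExt n f) {0}ᶜ := by
  intro y hy z hz hyz
  rw [coneExt_of_ne hy, coneExt_of_ne hz] at hyz
  have hy' := norm_pos_iff.2 hy
  have h1 : ‖y‖ = ‖z‖ := by simpa [norm_smul] using congrArg norm hyz
  rw [← h1] at hyz
  have h2 := hf (Subtype.ext (smul_right_injective _ hy'.ne' hyz))
  rw [← norm_smul_radialProj hy, ← norm_smul_radialProj hz, h1, h2]

theorem coneExt_image (f : Sph n → Sph n) (s : Set (Sph n)) :
    coneExt n f '' (Ioo (0 : ℝ) 1 • ((↑) '' s : Set (Amb n))) =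
      Ioo (0 : ℝ) 1 • ((↑) '' (f '' s) : Set (Amb n)) := by
  have key : ∀ c ∈ Ioo (0 : ℝ) 1, ∀ x : Sph n, coneExt n f (c • (x : Amb n)) = c • (f x : Amb n) :=
    fun c hc x => by rw [coneExt_smul hc.1, coneExt, norm_coe_sph, one_smul, radialExt_coe]
  ext y
  constructor
  · rintro ⟨_, ⟨c, hc, _, ⟨x, hx, rfl⟩, rfl⟩, rfl⟩
    exact ⟨c, hc, f x, ⟨_, ⟨x, hx, rfl⟩, rfl⟩, (key c hc x).symm⟩
  · rintro ⟨c, hc, _, ⟨_, ⟨x, hx, rfl⟩, rfl⟩, rfl⟩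
    exact ⟨c • (x : Amb n), ⟨c, hc, x, ⟨x, hx, rfl⟩, rfl⟩, key c hc x⟩

/-- The change of variables formula on the sphere. -/
theorem surfaceMeasure_image {f : Sph n → Sph n} (hf : Function.Injective f)
    (hd : ∀ x : Sph n, DifferentiableAt ℝ (radialExt n f) x)
    (hm : Measurable (densityUpdate n f)) {s : Set (Sph n)} (hs : MeasurableSet s)
    (hfs : MeasurableSet (f '' s)) :
    surfaceMeasure n (f '' s) = ∫⁻ x in s, ENNReal.ofReal (densityUpdate n f x) ∂surfaceMeasure n := by
  have hC : MeasurableSet (radialProj n ⁻¹' s ∩ (ball (0 : Amb n) 1 \ {0})) :=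
    (measurable_radialProj hs).inter (measurableSet_ball.diff (measurableSet_singleton 0))
  -- Euclidean change of variables for the cone map, which carries the cone over `s` bijectively
  -- onto the cone over `f '' s`.
  have h1 := lintegral_abs_det_fderiv_eq_addHaar_image (volume : Measure (Amb n)) (f := coneExt n f)
    (f' := fun y => fderiv ℝ (radialExt n f) (radialProj n y) +
      (innerSL ℝ (radialProj n y : Amb n)).smulRight (f (radialProj n y) : Amb n)) hC
    (fun y hy => by
      have h := hasFDerivAt_coneExt_smul (hasFDerivAt_coneExt (hd (radialProj n y)))
        (norm_pos_iff.2 hy.2.2)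
      rw [norm_smul_radialProj hy.2.2] at h
      exact h.hasFDerivWithinAt)
    ((injOn_coneExt hf).mono fun y hy => hy.2.2)
  simp only [abs_det_fderiv_coneExt (hd _)] at h1
  rw [surfaceMeasure, Measure.toSphere_apply' _ hfs, ← coneExt_image, Ioo_smul_image_coe, ← h1,
    ← surfaceMeasure, surfaceMeasure_eq_map, Measure.restrict_smul, lintegral_smul_measure,
    setLIntegral_map hs hm.ennreal_ofReal measurable_radialProj,
    Measure.restrict_restrict (measurable_radialProj hs), finrank_euclideanSpace, Fintype.card_fin,
    smul_eq_mul]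

end VMF

/-! ### Axial maps of the sphere and their Jacobian -/

namespace VMF

open Filter Topology

/-- The profile `g` of an axial self-map of the sphere, together with the smooth positive function
`r` that extends `√((1 - g²) / (1 - x²))` to `[-1, 1]`. -/
structure IsAxialProfile (g r : ℝ → ℝ) : Prop where
  mapsTo : MapsTo g (Icc (-1) 1) (Icc (-1) 1)
  contDiffOn : ContDiffOn ℝ ∞ g (Icc (-1) 1)
  contDiffOn_scale : ContDiffOn ℝ ∞ r (Icc (-1) 1)
  scale_pos : ∀ x ∈ Icc (-1 : ℝ) 1, 0 < r x
  one_sub_sq_eq : ∀ x ∈ Icc (-1 : ℝ) 1, 1 - g x ^ 2 = r x ^ 2 * (1 - x ^ 2)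

variable {n : ℕ} {g r k r' : ℝ → ℝ}

noncomputable section

/-- The unit vector of the last coordinate axis. -/
def axis (n : ℕ) : Amb n := EuclideanSpace.single (Fin.last n) 1

/-- The last coordinate as a continuous linear form. -/
def axisCoord (n : ℕ) : Amb n →L[ℝ] ℝ := EuclideanSpace.proj (Fin.last n)

/-- A smooth form of `axialMap`, which agrees with it on the unit sphere. -/
def smoothAxialMap (n : ℕ) (g r : ℝ → ℝ) (x : Amb n) : Amb n :=
  r (axisCoord n x) • x +
    (g (axisCoord n x) - axisCoord n x * r (axisCoord n x)) • axis n

end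

theorem norm_axis : ‖axis n‖ = 1 := by simp [axis]

theorem inner_axis (x : Amb n) : ⟪axis n, x⟫ = axisCoord n x := by
  simp [axis, axisCoord, EuclideanSpace.inner_single_left]

theorem axisCoord_axis : axisCoord n (axis n) = 1 := by
  rw [← inner_axis, real_inner_self_eq_norm_sq, norm_axis, one_pow]

theorem axisCoord_mem (x : Sph n) : axisCoord n x ∈ Icc (-1 : ℝ) 1 := by
  have h := abs_real_inner_le_norm (axis n) (x : Amb n)
  rw [inner_axis, norm_axis, norm_coe_sph, one_mul] at h
  exact abs_le.1 h

theorem norm_sub_smul_axis_sq (x : Sph n) :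
    ‖(x : Amb n) - axisCoord n x • axis n‖ ^ 2 = 1 - axisCoord n x ^ 2 := by
  rw [norm_sub_sq_real, norm_coe_sph, norm_smul, norm_axis, inner_smul_right, real_inner_comm,
    inner_axis, mul_one, Real.norm_eq_abs, sq_abs]
  ring

theorem eq_smul_axis_of_sq_eq_one {x : Sph n} (hx : 1 - axisCoord n x ^ 2 = 0) :
    (x : Amb n) = axisCoord n x • axis n := by
  have h := norm_sub_smul_axis_sq x
  rw [hx] at h
  exact sub_eq_zero.1 (norm_eq_zero.1 (pow_eq_zero_iff two_ne_zero |>.1 h))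

theorem axisCoord_smoothAxialMap (x : Amb n) :
    axisCoord n (smoothAxialMap n g r x) = g (axisCoord n x) := by
  simp only [smoothAxialMap, map_add, map_smul, smul_eq_mul, axisCoord_axis]
  ring

namespace IsAxialProfile

theorem axialMap_eq (H : IsAxialProfile g r) (x : Sph n) :
    axialMap n g x = smoothAxialMap n g r x := by
  have ht := axisCoord_mem x
  have e := H.one_sub_sq_eq _ ht
  ext i
  rw [axialMap]
  by_cases hi : i = Fin.last n
  · subst hi
    have := axisCoord_smoothAxialMap (g := g) (r := r) (x : Amb n)
    simpa [axisCoord] using this.symm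
  · have h1 : axis n i = 0 := by simp [axis, hi]
    have h2 : (x : Amb n) (Fin.last n) = axisCoord n x := rfl
    simp only [hi, if_false, h2, smoothAxialMap, PiLp.add_apply, PiLp.smul_apply, h1, smul_eq_mul,
      mul_zero, add_zero]
    -- At a pole the quotient under the root has denominator 0, but the coordinates it multiplies
    -- vanish.
    rcases eq_or_ne (1 - axisCoord n x ^ 2) 0 with h0 | h0
    · have h3 : (x : Amb n) i = 0 := by
        rw [eq_smul_axis_of_sq_eq_one h0]
        simp [h1]
      rw [h3, zero_mul, mul_zero]
    · rw [e, mul_div_cancel_right₀ _ h0, Real.sqrt_sq (H.scale_pos _ ht).le, mul_comm]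

theorem norm_smoothAxialMap (H : IsAxialProfile g r) (x : Sph n) :
    ‖smoothAxialMap n g r x‖ = 1 := by
  have e := H.one_sub_sq_eq _ (axisCoord_mem x)
  rw [← sq_eq_sq₀ (norm_nonneg _) zero_le_one, smoothAxialMap, norm_add_sq_real, norm_smul,
    norm_smul, norm_axis, norm_coe_sph, inner_smul_left, inner_smul_right, real_inner_comm,
    inner_axis, Real.norm_eq_abs, Real.norm_eq_abs, mul_one, mul_one, sq_abs, sq_abs]
  simp only [conj_trivial]
  linear_combination -e

/-- The self-map of the sphere with the given axial profile. -/
noncomputable def selfMap (H : IsAxialProfile g r) (n : ℕ) (x : Sph n) : Sph n :=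
  ⟨smoothAxialMap n g r x, by simpa using H.norm_smoothAxialMap x⟩

theorem coe_selfMap (H : IsAxialProfile g r) (x : Sph n) :
    (H.selfMap n x : Amb n) = smoothAxialMap n g r x := rfl

theorem selfMap_selfMap (H : IsAxialProfile g r) (H' : IsAxialProfile k r')
    (hk : ∀ x ∈ Icc (-1 : ℝ) 1, k (g x) = x) (x : Sph n) :
    H'.selfMap n (H.selfMap n x) = x := by
  apply Subtype.ext
  have ht := axisCoord_mem x
  have e := H.one_sub_sq_eq _ ht
  have e' := H'.one_sub_sq_eq _ (H.mapsTo ht)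
  rw [hk _ ht] at e'
  have hp := mul_pos (H.scale_pos _ ht) (H'.scale_pos _ (H.mapsTo ht))
  -- Off the poles `r'(g t) r(t)` is positive with square 1, hence 1; at the poles the component
  -- orthogonal to the axis vanishes.
  have key : (1 - r' (g (axisCoord n x)) * r (axisCoord n x)) •
      ((x : Amb n) - axisCoord n x • axis n) = 0 := by
    rcases eq_or_ne (1 - axisCoord n x ^ 2) 0 with h0 | h0
    · rw [sub_eq_zero.2 (eq_smul_axis_of_sq_eq_one h0), smul_zero]
    · rw [e] at e'
      have h1 : (r (axisCoord n x) * r' (g (axisCoord n x))) ^ 2 = 1 := by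
        refine mul_right_cancel₀ h0 ?_
        linear_combination -e'
      have h2 := (pow_eq_one_iff_of_nonneg hp.le two_ne_zero).1 h1
      rw [mul_comm, h2, sub_self, zero_smul]
  rw [coe_selfMap, smoothAxialMap, coe_selfMap, axisCoord_smoothAxialMap, hk _ ht, smoothAxialMap]
  refine Eq.trans ?_ (sub_eq_self.2 key)
  module

/-- Smoothness within `[-1, 1]` is enough, poles included, because the last coordinate maps the
whole sphere into that interval. -/
theorem contMDiff_comp_axisCoord {φ : ℝ → ℝ} (hφ : ContDiffOn ℝ ∞ φ (Icc (-1) 1)) :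
    ContMDiff (𝓡 n) 𝓘(ℝ) ∞ fun x : Sph n => φ (axisCoord n x) := by
  have := Fact.mk (@finrank_euclideanSpace_fin ℝ _ (n + 1))
  have h1 : ContMDiff (𝓡 n) 𝓘(ℝ) ∞ fun x : Sph n => axisCoord n x :=
    (axisCoord n).contDiff.contMDiff.comp contMDiff_coe_sphere
  rw [← contMDiffOn_univ] at h1 ⊢
  exact hφ.contMDiffOn.comp h1 fun x _ => axisCoord_mem x

theorem contMDiff_selfMap (H : IsAxialProfile g r) :
    ContMDiff (𝓡 n) (𝓡 n) ∞ (H.selfMap n) := by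
  have := Fact.mk (@finrank_euclideanSpace_fin ℝ _ (n + 1))
  have h : ContMDiff (𝓡 n) 𝓘(ℝ, Amb n) ∞ fun x : Sph n => smoothAxialMap n g r x := by
    have h1 : ContMDiff (𝓡 n) 𝓘(ℝ) ∞ fun x : Sph n =>
        g (axisCoord n x) - axisCoord n x * r (axisCoord n x) :=
      contMDiff_comp_axisCoord (φ := fun t => g t - t * r t)
        (H.contDiffOn.sub (contDiffOn_id.mul H.contDiffOn_scale))
    have h2 : ContMDiff (𝓡 n) 𝓘(ℝ, Amb n) ∞ fun _ : Sph n => axis n := contMDiff_const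
    exact ((contMDiff_comp_axisCoord H.contDiffOn_scale).smul contMDiff_coe_sphere).add
      (h1.smul h2)
  exact h.codRestrict_sphere fun x => by simpa using H.norm_smoothAxialMap x

end IsAxialProfile

section Gram

theorem hasFDerivAt_norm_inv_smul (x : Sph n) :
    HasFDerivAt (fun y : Amb n => ‖y‖⁻¹ • y)
      (ContinuousLinearMap.id ℝ (Amb n) - (innerSL ℝ (x : Amb n)).smulRight (x : Amb n)) x := by
  have h1 := hasFDerivAt_norm_sph x
  have h2 : HasFDerivAt (fun y : Amb n => ‖y‖⁻¹) (-innerSL ℝ (x : Amb n)) x := by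
    have := (hasDerivAt_inv (by simp : ‖(x : Amb n)‖ ≠ 0)).comp_hasFDerivAt (x : Amb n) h1
    refine this.congr_fderiv ?_
    simp
  refine (h2.smul (hasFDerivAt_id _)).congr_fderiv ?_
  ext v
  simp [sub_eq_add_neg]

theorem axisCoord_norm_inv_smul_mem (y : Amb n) : axisCoord n (‖y‖⁻¹ • y) ∈ Icc (-1 : ℝ) 1 := by
  rcases eq_or_ne y 0 with rfl | hy
  · simp
  · rw [← coe_radialProj hy]
    exact axisCoord_mem _

/-- The derivative at `x` of the radial extension of the map with axial profile `g`. -/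
theorem IsAxialProfile.hasFDerivAt_radialExt (H : IsAxialProfile g r) (x : Sph n) :
    ∃ J : Amb n →L[ℝ] Amb n, HasFDerivAt (radialExt n (H.selfMap n)) J x ∧
      ∀ v : Amb n, ⟪(x : Amb n), v⟫ = 0 → J v = r (axisCoord n x) • v + axisCoord n v •
        (derivWithin r (Icc (-1) 1) (axisCoord n x) • (x : Amb n) +
          (derivWithin g (Icc (-1) 1) (axisCoord n x) - r (axisCoord n x) -
            axisCoord n x * derivWithin r (Icc (-1) 1) (axisCoord n x)) • axis n) := by
  have ht := axisCoord_mem x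
  have hP := hasFDerivAt_norm_inv_smul x
  set P := ContinuousLinearMap.id ℝ (Amb n) - (innerSL ℝ (x : Amb n)).smulRight (x : Amb n)
  have hx : ‖(x : Amb n)‖⁻¹ • (x : Amb n) = x := by rw [norm_coe_sph, inv_one, one_smul]
  have hτ : HasFDerivAt (fun y : Amb n => axisCoord n (‖y‖⁻¹ • y)) (axisCoord n ∘L P) x :=
    (axisCoord n).hasFDerivAt.comp _ hP
  -- The chain rule with one-sided derivatives: the coordinate of `y/‖y‖` never leaves `[-1, 1]`, so
  -- the values of `φ` outside do not matter.
  have hcomp : ∀ φ : ℝ → ℝ, DifferentiableOn ℝ φ (Icc (-1) 1) →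
      HasFDerivAt (fun y : Amb n => φ (axisCoord n (‖y‖⁻¹ • y)))
        (derivWithin φ (Icc (-1) 1) (axisCoord n x) • (axisCoord n ∘L P)) x := by
    intro φ hφ
    have h1 : HasDerivWithinAt φ (derivWithin φ (Icc (-1) 1) (axisCoord n x)) (Icc (-1) 1)
        (axisCoord n (‖(x : Amb n)‖⁻¹ • (x : Amb n))) := by
      rw [hx]; exact (hφ _ ht).hasDerivWithinAt
    rw [← hasFDerivWithinAt_univ] at hτ ⊢
    exact h1.comp_hasFDerivWithinAt (x : Amb n) hτ fun y _ => axisCoord_norm_inv_smul_mem y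
  have hr := hcomp r (H.contDiffOn_scale.differentiableOn (by simp))
  have hg := hcomp g (H.contDiffOn.differentiableOn (by simp))
  have hS := (hr.smul hP).add ((hg.sub (hτ.mul hr)).smul_const (axis n))
  refine ⟨_, hS.congr_of_eventuallyEq ?_, fun v hv => ?_⟩
  · filter_upwards [isOpen_compl_singleton.mem_nhds (coe_sph_ne_zero x)] with y hy
    rw [radialExt_of_ne hy, H.coe_selfMap, coe_radialProj hy]
    rfl
  · have hPv : P v = v := by simp [P, hv]
    simp only [add_apply, smul_apply,
      ContinuousLinearMap.smulRight_apply, sub_apply,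
      ContinuousLinearMap.comp_apply, hPv, hx, smul_eq_mul]
    module

/-- The algebraic identity behind the determinant of the Gram operator. -/
theorem gram_determinant_identity {t r s k k' : ℝ} (h1 : r * s * (1 - t ^ 2) = t * r ^ 2 - k * k')
    (h2 : 1 - k ^ 2 = r ^ 2 * (1 - t ^ 2)) {b c : ℝ} (hb : b = k' - r - t * s)
    (hc : c = 2 * r * b + (s ^ 2 + 2 * s * b * t + b ^ 2)) :
    r ^ 2 * (r ^ 2 + c * (1 - t ^ 2)) = k' ^ 2 := by
  subst hc hb
  linear_combination (r * s * (1 - t ^ 2) - t * r ^ 2 - k * k') * h1 - k' ^ 2 * h2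

/-- On `x^⊥` the Gram operator is `r² + c e ⊗ e`, where `e` is the tangential part of the axis and
`‖e‖² = 1 - t²`. Its determinant is `r^(2n-2) (r² + c(1-t²))`, and `gram_determinant_identity`
evaluates the last factor as `(g'/r)²`. At a pole `e = 0` and the same formula holds. -/
theorem IsAxialProfile.densityUpdate_selfMap (H : IsAxialProfile g r) (x : Sph n)
    (hg' : 0 ≤ derivWithin g (Icc (-1) 1) (axisCoord n x)) :
    densityUpdate n (H.selfMap n) x = (r (axisCoord n x) ^ 2) ^ ((n : ℝ) / 2 - 1) *
      derivWithin g (Icc (-1) 1) (axisCoord n x) := by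
  obtain ⟨J, hJ, hJv⟩ := H.hasFDerivAt_radialExt x
  have ht := axisCoord_mem x
  have hrpos := H.scale_pos _ ht
  have e1 := IsTransport.mul_derivWithin_eq (H.contDiffOn.differentiableOn (by simp))
    (H.contDiffOn_scale.differentiableOn (by simp)) H.one_sub_sq_eq ht
  have e2 := H.one_sub_sq_eq _ ht
  rw [densityUpdate, hJ.fderiv]
  set t := axisCoord n x with ht_def
  set s := derivWithin r (Icc (-1) 1) t
  set k' := derivWithin g (Icc (-1) 1) t
  obtain ⟨b, hb⟩ : ∃ b, b = k' - r t - t * s := ⟨_, rfl⟩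
  -- The coefficient of `⟪e, v⟫ ⟪e, w⟫` in `⟪J v, J w⟫`, where `J v = r v + ⟪e, v⟫ (s x + b axis)`:
  -- the cross terms give `2rb`, and `‖s x + b axis‖²` gives the rest.
  obtain ⟨c, hc⟩ : ∃ c, c = 2 * r t * b + (s ^ 2 + 2 * s * b * t + b ^ 2) := ⟨_, rfl⟩
  rw [← hb] at hJv
  have e3 := gram_determinant_identity e1 e2 hb hc
  have hxx : ⟪(x : Amb n), (x : Amb n)⟫ = 1 := by
    rw [real_inner_self_eq_norm_sq, norm_coe_sph, one_pow]
  have haa : ⟪axis n, axis n⟫ = 1 := by rw [inner_axis, axisCoord_axis]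
  have hax : ⟪axis n, (x : Amb n)⟫ = t := inner_axis _
  have hxa : ⟪(x : Amb n), axis n⟫ = t := by rw [real_inner_comm, hax]
  have heK : axis n - t • (x : Amb n) ∈ (ℝ ∙ (x : Amb n))ᗮ := by
    rw [Submodule.mem_orthogonal_singleton_iff_inner_right, inner_sub_right, inner_smul_right, hxx,
      hxa]
    ring
  set e : (ℝ ∙ (x : Amb n))ᗮ := ⟨axis n - t • (x : Amb n), heK⟩ with he
  have hen : ‖e‖ ^ 2 = 1 - t ^ 2 := by
    rw [Submodule.coe_norm, he, ← real_inner_self_eq_norm_sq, inner_sub_left, inner_sub_right,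
      inner_sub_right, inner_smul_left, inner_smul_right, inner_smul_left, inner_smul_right,
      hxx, haa, hax, hxa]
    simp only [conj_trivial]
    ring
  have hq : r t ^ 2 ≠ 0 := (pow_pos hrpos 2).ne'
  have hdet := det_eq_of_inner_eq (q := r t ^ 2) (c := c) hq e
    ((ContinuousLinearMap.adjoint (J ∘L (ℝ ∙ (x : Amb n))ᗮ.subtypeL) ∘L
      (J ∘L (ℝ ∙ (x : Amb n))ᗮ.subtypeL) :
      (ℝ ∙ (x : Amb n))ᗮ →L[ℝ] (ℝ ∙ (x : Amb n))ᗮ) :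
      (ℝ ∙ (x : Amb n))ᗮ →ₗ[ℝ] (ℝ ∙ (x : Amb n))ᗮ) (fun v w => by
    have hv := Submodule.mem_orthogonal_singleton_iff_inner_right.1 v.2
    have hw := Submodule.mem_orthogonal_singleton_iff_inner_right.1 w.2
    have hev : ∀ u : (ℝ ∙ (x : Amb n))ᗮ, ⟪e, u⟫ = axisCoord n u := fun u => by
      have hu := Submodule.mem_orthogonal_singleton_iff_inner_right.1 u.2
      rw [Submodule.coe_inner, he, inner_sub_left, inner_smul_left, hu, mul_zero, sub_zero,
        inner_axis]
    rw [hev, hev, ContinuousLinearMap.coe_coe, ContinuousLinearMap.comp_apply,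
      ContinuousLinearMap.adjoint_inner_left, ContinuousLinearMap.comp_apply,
      ContinuousLinearMap.comp_apply, Submodule.subtypeL_apply, Submodule.subtypeL_apply,
      hJv _ hv, hJv _ hw, Submodule.coe_inner]
    have hv' : ⟪(v : Amb n), (x : Amb n)⟫ = 0 := by rw [real_inner_comm, hv]
    have hva : ⟪(v : Amb n), axis n⟫ = axisCoord n v := by rw [real_inner_comm, inner_axis]
    simp only [inner_add_left, inner_add_right, inner_smul_left, inner_smul_right, conj_trivial,
      hv', hw, hva, inner_axis, hxx, haa, hax, hxa]
    rw [hc]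
    ring)
  have := Fact.mk (@finrank_euclideanSpace_fin ℝ _ (n + 1))
  have hfin : Module.finrank ℝ (ℝ ∙ (x : Amb n))ᗮ = n :=
    Submodule.finrank_orthogonal_span_singleton (coe_sph_ne_zero x)
  rw [hdet, hen, hfin]
  have hX : 0 < r t ^ 2 := pow_pos hrpos 2
  have h1 : ((r t ^ 2) ^ ((n : ℝ) / 2 - 1)) ^ 2 * (r t ^ 2) ^ 2 = (r t ^ 2) ^ n := by
    rw [← mul_pow, ← Real.rpow_add_one hX.ne', sub_add_cancel, ← Real.rpow_natCast,
      ← Real.rpow_mul hX.le]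
    push_cast
    rw [div_mul_cancel₀ _ two_ne_zero, Real.rpow_natCast]
  have h2 : (r t ^ 2) ^ n * (1 + c / r t ^ 2 * (1 - t ^ 2)) =
      ((r t ^ 2) ^ ((n : ℝ) / 2 - 1) * k') ^ 2 := by
    rw [← h1, mul_pow, ← e3]
    field_simp
  rw [h2, Real.sqrt_sq (mul_nonneg (Real.rpow_nonneg hX.le _) hg')]

end Gram

end VMF

/-! ### The profile `h` and the von Mises-Fisher density -/

namespace VMF

open Filter Topology

theorem IsTransport.exists_isAxialProfile {a : ℝ} {ρ₁ ρ₂ g : ℝ → ℝ} (T : IsTransport a ρ₁ ρ₂ g) :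
    ∃ r, IsAxialProfile g r := by
  obtain ⟨r, hr, hr'⟩ := T.exists_one_sub_sq_eq
  exact ⟨r, T.mapsTo, T.contDiffOn, hr, fun x hx => (hr' x hx).1, fun x hx => (hr' x hx).2⟩

/-- The density update of the axial self-map whose profile transports `wt (n/2) ρ₁` to
`wt (n/2) ρ₂`. -/
theorem IsTransport.densityUpdate_selfMap {n : ℕ} {ρ₁ ρ₂ g r : ℝ → ℝ}
    (T : IsTransport (n / 2) ρ₁ ρ₂ g) (H : IsAxialProfile g r) (x : Sph n) :
    densityUpdate n (H.selfMap n) x = ρ₁ (axisCoord n x) / ρ₂ (g (axisCoord n x)) := by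
  have ht := axisCoord_mem x
  have e := T.rpow_mul_derivWithin_eq H.contDiffOn_scale.continuousOn
    (fun y hy => ⟨H.scale_pos y hy, H.one_sub_sq_eq y hy⟩) ht
  have h2 := T.pos_right (g (axisCoord n x))
  have h3 : 0 < (r (axisCoord n x) ^ 2) ^ ((n : ℝ) / 2 - 1) :=
    Real.rpow_pos_of_pos (pow_pos (H.scale_pos _ ht) 2) _
  rw [H.densityUpdate_selfMap x, ← e, mul_div_cancel_right₀ _ h2.ne']
  exact T.strictMonoOn.monotoneOn.derivWithin_nonneg

section Profile

variable {n : ℕ} {κ : ℝ}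

theorem bijOn_U (hn : 1 ≤ n) : BijOn (U (n + 1)) (Icc (-1) 1) (Icc 0 1) := by
  have h := bijOn_cumul (ρ := fun _ => uConst n) (half_pos_of_one_le hn) continuous_const
    (fun _ => uConst_pos hn)
  rw [← U_eq_cumul right_mem, U_one hn] at h
  exact h.congr fun x hx => (U_eq_cumul hx).symm

theorem bijOn_F (hn : 1 ≤ n) (hκ : 0 < κ) : BijOn (F (n + 1) κ) (Icc (-1) 1) (Icc 0 1) := by
  have h := bijOn_cumul (ρ := fun t => fConst n κ * Real.exp (κ * t)) (half_pos_of_one_le hn)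
    (by fun_prop) (fun t => mul_pos (fConst_pos hn hκ) (Real.exp_pos _))
  rw [← F_eq_cumul, F_one hn hκ] at h
  exact h.congr fun x _ => (F_eq_cumul x).symm

theorem h_mem (hn : 1 ≤ n) (hκ : 0 < κ) {x : ℝ} (hx : x ∈ Icc (-1 : ℝ) 1) :
    h (n + 1) κ x ∈ Icc (-1 : ℝ) 1 :=
  Function.invFunOn_mem ((bijOn_F hn hκ).surjOn ((bijOn_U hn).mapsTo hx))

theorem F_h (hn : 1 ≤ n) (hκ : 0 < κ) {x : ℝ} (hx : x ∈ Icc (-1 : ℝ) 1) :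
    F (n + 1) κ (h (n + 1) κ x) = U (n + 1) x :=
  Function.invFunOn_eq ((bijOn_F hn hκ).surjOn ((bijOn_U hn).mapsTo hx))

theorem isTransport_h (hn : 1 ≤ n) (hκ : 0 < κ) :
    IsTransport (n / 2) (fun _ => uConst n) (fun t => fConst n κ * Real.exp (κ * t))
      (h (n + 1) κ) where
  exponent_pos := half_pos_of_one_le hn
  smooth_left := contDiff_const
  pos_left _ := uConst_pos hn
  smooth_right := by fun_prop
  pos_right t := mul_pos (fConst_pos hn hκ) (Real.exp_pos _)
  mass_eq := by rw [← U_eq_cumul right_mem, ← F_eq_cumul, U_one hn, F_one hn hκ]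
  mapsTo _ hx := h_mem hn hκ hx
  cumul_eq x hx := by rw [← U_eq_cumul hx, ← F_eq_cumul, F_h hn hκ hx]

theorem bijOn_h (hn : 1 ≤ n) (hκ : 0 < κ) :
    BijOn (h (n + 1) κ) (Icc (-1) 1) (Icc (-1) 1) := by
  refine ⟨fun x hx => h_mem hn hκ hx, (isTransport_h hn hκ).strictMonoOn.injOn, fun y hy => ?_⟩
  obtain ⟨x, hx, hxy⟩ := (bijOn_U hn).surjOn ((bijOn_F hn hκ).mapsTo hy)
  exact ⟨x, hx, (bijOn_F hn hκ).injOn (h_mem hn hκ hx) hy ((F_h hn hκ hx).trans hxy)⟩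

/-- Transport is symmetric in the two weights, so smoothness of the inverse and the Jacobian of the
inverse sphere map need no separate argument. -/
theorem isTransport_invFunOn_h (hn : 1 ≤ n) (hκ : 0 < κ) :
    IsTransport (n / 2) (fun t => fConst n κ * Real.exp (κ * t)) (fun _ => uConst n)
      (Function.invFunOn (h (n + 1) κ) (Icc (-1) 1)) where
  exponent_pos := half_pos_of_one_le hn
  smooth_left := by fun_prop
  pos_left t := mul_pos (fConst_pos hn hκ) (Real.exp_pos _)
  smooth_right := contDiff_const
  pos_right _ := uConst_pos hn
  mass_eq := (isTransport_h hn hκ).mass_eq.symm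
  mapsTo _ hx := Function.invFunOn_mem ((bijOn_h hn hκ).surjOn hx)
  cumul_eq x hx := by
    have hmem := Function.invFunOn_mem ((bijOn_h hn hκ).surjOn hx)
    have heq := Function.invFunOn_eq ((bijOn_h hn hκ).surjOn hx)
    rw [← U_eq_cumul hmem, ← F_h hn hκ hmem, heq, F_eq_cumul]

end Profile

/-- A measurable bijection of the sphere maps the uniform measure to the measure whose density is given by the change of variables through the inverse map. -/
theorem map_uniformMeasure_eq {n : ℕ} (Φ : Sph n ≃ Sph n) (hΦ : Measurable Φ)
    (hd : ∀ x : Sph n, DifferentiableAt ℝ (radialExt n Φ.symm) x) {p : Sph n → ℝ}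
    (hp : Measurable p) (hflow : ∀ z, flowDensity n (uniformDensity n) Φ.symm z = p z) :
    Measure.map Φ (uniformMeasure n) =
      (surfaceMeasure n).withDensity fun z => ENNReal.ofReal (p z) := by
  have hσ : 0 < (surfaceMeasure n).real univ := by
    rw [surfaceMeasure_real_univ]
    have := Real.Gamma_pos_of_pos (by positivity : (0 : ℝ) < ((n : ℝ) + 1) / 2)
    positivity
  have hσ' : surfaceMeasure n univ = ENNReal.ofReal ((surfaceMeasure n).real univ) := by
    have hne : surfaceMeasure n univ ≠ ⊤ := fun h => by simp [Measure.real, h] at hσ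
    rw [Measure.real, ENNReal.ofReal_toReal hne]
  have hupd : densityUpdate n Φ.symm = fun z => (surfaceMeasure n).real univ * p z := by
    funext z
    rw [← hflow, flowDensity, uniformDensity, mul_inv_cancel_left₀ hσ.ne']
  -- Measurability of the density update is inherited from `p`, to which it is proportional by
  -- `hflow`.
  have hm : Measurable (densityUpdate n Φ.symm) := by
    rw [hupd]
    exact hp.const_mul _
  ext s hs
  have himg : Φ ⁻¹' s = Φ.symm '' s := (Φ.image_symm_eq_preimage s).symm
  rw [Measure.map_apply hΦ hs, withDensity_apply _ hs, uniformMeasure, Measure.smul_apply, himg,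
    surfaceMeasure_image Φ.symm.injective hd hm hs (himg ▸ hΦ hs), smul_eq_mul, hσ',
    ← ENNReal.ofReal_inv_of_pos hσ, ← lintegral_const_mul _ hm.ennreal_ofReal]
  refine lintegral_congr fun z => ?_
  rw [← ENNReal.ofReal_mul (inv_nonneg.2 hσ.le), hupd, inv_mul_cancel_left₀ hσ.ne']

end VMF

theorem theorem3p2 (n : ℕ) (hn : 1 ≤ n) (κ : ℝ) (hκ : 0 < κ) :
    Set.BijOn (VMF.U (n + 1)) (Set.Icc (-1) 1) (Set.Icc 0 1) ∧
    Set.BijOn (VMF.F (n + 1) κ) (Set.Icc (-1) 1) (Set.Icc 0 1) ∧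
    VMF.IsDiffeoOn (VMF.h (n + 1) κ) (Set.Icc (-1) 1) ∧
    ∃ Φ : VMF.Sph n ≃ₘ⟮𝓡 n, 𝓡 n⟯ VMF.Sph n,
      (∀ x : VMF.Sph n, (Φ x : VMF.Amb n) = VMF.axialMap n (VMF.h (n + 1) κ) x) ∧
      MeasureTheory.Measure.map Φ (VMF.uniformMeasure n) =
        VMF.vmfMeasure n (VMF.northPole n) κ ∧
      ∀ z : VMF.Sph n,
        VMF.flowDensity n (VMF.uniformDensity n) Φ.symm z =
          VMF.vmfDensity n (VMF.northPole n) κ z := by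
  have T := VMF.isTransport_h hn hκ
  have T' := VMF.isTransport_invFunOn_h hn hκ
  have hb := VMF.bijOn_h hn hκ
  refine ⟨VMF.bijOn_U hn, VMF.bijOn_F hn hκ, ⟨hb, T.contDiffOn, T'.contDiffOn⟩, ?_⟩
  obtain ⟨r, H⟩ := T.exists_isAxialProfile
  obtain ⟨r', H'⟩ := T'.exists_isAxialProfile
  have hinv : InvOn (Function.invFunOn (VMF.h (n + 1) κ) (Icc (-1) 1)) (VMF.h (n + 1) κ)
      (Icc (-1) 1) (Icc (-1) 1) := hb.invOn_invFunOn
  let Φ : VMF.Sph n ≃ₘ⟮𝓡 n, 𝓡 n⟯ VMF.Sph n :=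
    { toFun := H.selfMap n
      invFun := H'.selfMap n
      left_inv := H.selfMap_selfMap H' fun x hx => hinv.1 hx
      right_inv := H'.selfMap_selfMap H fun x hx => hinv.2 hx
      contMDiff_toFun := H.contMDiff_selfMap
      contMDiff_invFun := H'.contMDiff_selfMap }
  have hflow : ∀ z : VMF.Sph n, VMF.flowDensity n (VMF.uniformDensity n) Φ.symm z =
      VMF.vmfDensity n (VMF.northPole n) κ z := by
    intro z
    change _ * VMF.densityUpdate n (H'.selfMap n) z = _
    -- The inverse profile transports the exponential weight to the constant one, so the update is
    -- `fConst n κ * exp (κ t) / uConst n`.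
    rw [T'.densityUpdate_selfMap H' z, VMF.uniformDensity, VMF.vmfDensity,
      ← VMF.inv_surface_mul_fConst_div_uConst hn hκ]
    change _ = _ * Real.exp (κ * ⟪VMF.axis n, (z : VMF.Amb n)⟫)
    rw [VMF.inner_axis]
    ring
  refine ⟨Φ, fun x => (H.axialMap_eq x).symm, ?_, hflow⟩
  refine VMF.map_uniformMeasure_eq Φ.toEquiv Φ.continuous.measurable (fun x => ?_) ?_ hflow
  · obtain ⟨J, hJ, -⟩ := H'.hasFDerivAt_radialExt x
    exact hJ.differentiableAt
  · refine Continuous.measurable ?_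
    unfold VMF.vmfDensity
    fun_prop
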